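/- **Setting.** Let $\gamma_-,\gamma_+>0$ and let $v:\mathbb R\to\mathbb R$ be a $1$-periodic function, continuous on $[0,1)$, with $v(0)=0$, $\lim_{x\to1^-}v(x)=1$ and $$\gamma_-(y-x)\le v(y)-v(x)\le\gamma_+(y-x)\qquad(0\le x\le y<1).$$ For $\alpha\in\mathbb R\setminus\mathbb Q$ and $\lambda\in\mathbb R$ let $$(H(x)\psi)(m)=\psi(m+1)+\psi(m-1)+\lambda v(x+m\alpha)\psi(m),\qquad m\in\mathbb Z,$$ let $H_n(x)$ be the Dirichlet restriction of $H(x)$ to $\ell^2[0,n-1]$, and let $P_n(x,E)=\det(H_n(x)-E)$. Let $$M_n(x,E)=\prod_{l=n-1}^{0}\begin{pmatrix}E-\lambda v(x+l\alpha)&-1\\1&0\end{pmatrix},\qquad \gamma(E)=\inf_{n\ge1}\frac1n\int_{[0,1)}\ln\|M_n(x,E)\|\,dx$$ (the Lyapunov exponent; the infimum is also the limit as $n\to\infty$). Let $q_k$ be the denominators of the continued fraction convergents of $\alpha$, and put $$\mathrm{er}(\alpha)=\liminf_{k\to\infty}\frac{q_{k-1}}{q_{k+1}},\qquad Q(\alpha,\mathrm{er})=\Big\{q_k:\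 k\ge1,\ \frac{q_{k-1}}{q_{k+1}}\le \mathrm{er}\Big\}.$$ **Theorem 5.2.** Let $\gamma_-,\gamma_+>0$, $\lambda\in\mathbb R$, $\mathrm{er}<1$, and let $[E_1,E_2]$ be a compact interval. There is a constant $C>0$, and for every $\delta>0$ there is $q_0>0$, such that the following holds for every irrational $\alpha$ with $\mathrm{er}(\alpha)<\mathrm{er}$, every $v$ as above, every $E\in[E_1,E_2]$ with $\gamma(E)>0$, and every $q\in Q(\alpha,\mathrm{er})$ with $q\ge q_0$: the set $$\{x\in[0,1):\ |P_q(x,E)|<e^{q(\gamma(E)-\delta)}\}$$ has Lebesgue measure less than $e^{-C\delta q}$, and, modulo $1$, it can be covered by at most $q$ intervals of length $e^{-C\delta q}$. (Thus $C$ depends only on $\gamma_-,\gamma_+,\mathrm{er},\lambda$ and the interval $[E_1,E_2]$, and $q_0$ depends only on these and on $\delta$.) -/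

import Mathlib

open Filter Topology MeasureTheory

noncomputable section

/-- A sawtooth potential: `v` is `1`-periodic, continuous on `[0,1)`, with `v(0) = 0` and
`v(1-0) = 1`, and bi-Lipschitz increasing on `[0,1)` with the constants `γm ≤ γp`. -/
structure IsSawtoothPotential (v : ℝ → ℝ) (γm γp : ℝ) : Prop where
  periodic : Function.Periodic v 1
  continuousOn : ContinuousOn v (Set.Ico 0 1)
  map_zero : v 0 = 0
  left_limit_one : Tendsto v (𝓝[<] 1) (𝓝 1)
  lipschitz_monotone : ∀ x ∈ Set.Ico (0 : ℝ) 1, ∀ y ∈ Set.Ico (0 : ℝ) 1, x ≤ y →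
    γm * (y - x) ≤ v y - v x ∧ v y - v x ≤ γp * (y - x)

/-- The quasiperiodic Schrödinger operator
`(H ψ)(m) = ψ(m+1) + ψ(m-1) + lam * v(x + m α) * ψ(m)`, as an operator on all sequences on `ℤ`. -/
def schrodingerOp (α lam : ℝ) (v : ℝ → ℝ) (x : ℝ) (ψ : ℤ → ℝ) (m : ℤ) : ℝ :=
  ψ (m + 1) + ψ (m - 1) + lam * v (x + m * α) * ψ m

/-- The Dirichlet restriction `H_n(x)` of the operator to `l²[0, n-1]`: its `(i, j)` entry is
`⟨δ_i, H δ_j⟩`. -/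
def dirichletMatrix (α lam : ℝ) (v : ℝ → ℝ) (n : ℕ) (x : ℝ) : Matrix (Fin n) (Fin n) ℝ :=
  Matrix.of fun i j =>
    schrodingerOp α lam v x (Pi.single ((j : ℕ) : ℤ) (1 : ℝ)) ((i : ℕ) : ℤ)

/-- `P_n(x, E) = det (H_n(x) - E)`. -/
def dirichletDet (α lam : ℝ) (v : ℝ → ℝ) (n : ℕ) (x E : ℝ) : ℝ :=
  (dirichletMatrix α lam v n x - E • (1 : Matrix (Fin n) (Fin n) ℝ)).det

/-- The `n`-step transfer matrix `M_n(x, E)`, the product of the one-step matrices at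
`x + (n-1) α, …, x + α, x`, in this order. -/
def transferMatrix (α lam : ℝ) (v : ℝ → ℝ) (x E : ℝ) : ℕ → Matrix (Fin 2) (Fin 2) ℝ
  | 0 => 1
  | n + 1 => !![E - lam * v (x + n * α), -1; 1, 0] * transferMatrix α lam v x E n

/-- The Lyapunov exponent `γ(E) = inf_{n ≥ 1} (1/n) ∫_{[0,1)} ln ‖M_n(x, E)‖ dx`, which is also
the limit of these quantities as `n → ∞`; `‖·‖` is the operator norm on Euclidean `ℝ²`. The
infimum is over numbers that are bounded below by `0`, because `det M_n = 1`. -/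
def lyapunov (α lam : ℝ) (v : ℝ → ℝ) (E : ℝ) : ℝ :=
  ⨅ n : ℕ+, (1 / (n : ℝ)) * ∫ x in Set.Ico (0 : ℝ) 1,
    Real.log ‖Matrix.toEuclideanCLM (𝕜 := ℝ) (transferMatrix α lam v x E n)‖

/-- `q_k`, the denominator (in lowest terms) of the `k`-th continued fraction convergent
`[a_0; a_1, …, a_k]` of `α`. -/
def cfDen (α : ℝ) (k : ℕ) : ℕ := (α.convergent k).den

/-- `liminf_k q_{k-1} / q_{k+1}`. -/
def erExponent (α : ℝ) : ℝ :=
  liminf (fun k : ℕ => (cfDen α k : ℝ) / (cfDen α (k + 2) : ℝ)) atTop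

/-- The good denominators `Q(α, er)`: those `q_k`, `k ≥ 1`, with `q_{k-1} / q_{k+1} ≤ er`. -/
def goodDenominators (α er : ℝ) : Set ℕ :=
  {q | ∃ k : ℕ, q = cfDen α (k + 1) ∧ (cfDen α k : ℝ) / (cfDen α (k + 2) : ℝ) ≤ er}

/-- The phases `x ∈ [0,1)` with `|P_q(x, E)| < e^{q (γ(E) - δ)}`. -/
def deviationSet (α lam : ℝ) (v : ℝ → ℝ) (q : ℕ) (E δ : ℝ) : Set ℝ :=
  {x | x ∈ Set.Ico (0 : ℝ) 1 ∧
    |dirichletDet α lam v q x E| < Real.exp (q * (lyapunov α lam v E - δ))}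

/-- `S` is covered, modulo `1`, by `N` intervals of length `l` (some of which may coincide): the
intervals are arcs of the circle `ℝ/ℤ` on which the phase `x` lives. -/
def CoveredByArcs (S : Set ℝ) (N : ℕ) (l : ℝ) : Prop :=
  ∃ c : Fin N → ℝ, ∀ x ∈ S, ∃ j : Fin N, ∃ n : ℤ, x + n ∈ Set.Icc (c j) (c j + l)

end

/-! Let `lam ≠ 0` and choose `s = ±1` with `s * lam = |lam|`. If p/q approximates α to order 1/q²,
the orbit segments of length q of any two phases nearly coincide mod 1: after a cyclic relabelling,
one lies to the right of the other by at most 3/q (`IsGoodApprox.exists_shift`). Since v increases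
away from its jump, the matrices s(H_q − E) at two phases are comparable in either direction except
at boundedly many sites. Weyl's inequality (`eigenvalue_le_of_entries`) then interlaces their
eigenvalues up to an index shift of 11, independent of q (`eigenvalue_le_of_phases`).

Consequently, if all eigenvalues at x stay η away from 0, the determinant at any y exceeds the one
at x by a factor at most (R/η)^44 (`prod_abs_le_of_interlace`). This survives a change of the two
boundary coefficients, and such changes recover the whole transfer matrix from determinants; so
|P_q(x)| controls ‖M_q(y)‖ for every y (`norm_transferMatrix_le`). As γ is an infimum of averages,
some y has ‖M_q(y)‖ > e^{q(γ−δ/4)}. A small |P_q(x)| therefore forces an exponentially small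
eigenvalue at x.

Such phases are rare. The eigenvalue whose index is the rank of x + kα in the orbit grows at rate at
least |lam| γ₋ while x + kα runs through [0,1) (`eigenvalue_branch_le`): whenever another orbit
point jumps from 1 to 0, the rank moves by exactly the loss in Weyl's inequality. So each of the q
branches is small on a single short arc (`coveredByArcs_small_eigenvalue`).

For `lam = 0` this monotonicity is lost, but P_q is then a Chebyshev polynomial in E and the
deviation set is empty. -/

/-! ### Eigenvalues of real symmetric matrices: Weyl's inequality and interlacing. -/

/-- A real symmetric matrix is orthogonally diagonalizable with nondecreasing eigenvalues. -/
theorem exists_monotone_diagonalization {n : ℕ} (A : Matrix (Fin n) (Fin n) ℝ) (hA : A.IsSymm) :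
    ∃ (e : Fin n → ℝ) (U : Matrix (Fin n) (Fin n) ℝ), Monotone e ∧ U * U.transpose = 1 ∧
      A = U * Matrix.diagonal e * U.transpose := by
  have hH : A.IsHermitian := by
    rw [Matrix.IsHermitian, Matrix.conjTranspose_eq_transpose_of_trivial]; exact hA
  let σ := Tuple.sort hH.eigenvalues
  have hsp := hH.spectral_theorem
  have hU := (Matrix.mem_unitaryGroup_iff).1 hH.eigenvectorUnitary.2
  rw [Matrix.star_eq_conjTranspose, Matrix.conjTranspose_eq_transpose_of_trivial] at hU
  rw [Unitary.conjStarAlgAut_apply] at hsp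
  rw [Matrix.star_eq_conjTranspose, Matrix.conjTranspose_eq_transpose_of_trivial] at hsp
  set V : Matrix (Fin n) (Fin n) ℝ := (hH.eigenvectorUnitary : Matrix (Fin n) (Fin n) ℝ)
  refine ⟨hH.eigenvalues ∘ σ, V.submatrix id σ, Tuple.monotone_sort _, ?_, ?_⟩
  · rw [Matrix.transpose_submatrix, Matrix.submatrix_mul_equiv, hU, Matrix.submatrix_id_id]
  · conv_lhs => rw [hsp]
    have : Matrix.diagonal (hH.eigenvalues ∘ σ) =
        (Matrix.diagonal (RCLike.ofReal ∘ hH.eigenvalues : Fin n → ℝ)).submatrix σ σ := by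
      rw [Matrix.submatrix_diagonal_equiv]; rfl
    rw [this, Matrix.transpose_submatrix, Matrix.submatrix_mul_equiv, Matrix.submatrix_mul_equiv,
      Matrix.submatrix_id_id]

theorem det_eq_prod_of_diagonalization {n : ℕ} {A U : Matrix (Fin n) (Fin n) ℝ} {e : Fin n → ℝ}
    (hU : U * U.transpose = 1) (hA : A = U * Matrix.diagonal e * U.transpose) :
    A.det = ∏ i, e i := by
  have h := congrArg Matrix.det hU
  rw [Matrix.det_mul, Matrix.det_one] at h
  rw [hA, Matrix.det_mul, Matrix.det_mul, Matrix.det_diagonal]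
  linear_combination (∏ i, e i) * h

theorem dotProduct_mulVec_of_diagonalization {n : ℕ} {A U : Matrix (Fin n) (Fin n) ℝ}
    {e : Fin n → ℝ} (hA : A = U * Matrix.diagonal e * U.transpose) (w : Fin n → ℝ) :
    w ⬝ᵥ A.mulVec w = ∑ k, e k * (U.transpose.mulVec w k) ^ 2 := by
  rw [hA, ← Matrix.mulVec_mulVec, ← Matrix.mulVec_mulVec, Matrix.dotProduct_mulVec,
    ← Matrix.mulVec_transpose, dotProduct]
  refine Finset.sum_congr rfl fun k _ => ?_
  rw [Matrix.mulVec_diagonal]; ring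

theorem sum_sq_of_orthogonal {n : ℕ} {U : Matrix (Fin n) (Fin n) ℝ}
    (hU : U * U.transpose = 1) (w : Fin n → ℝ) :
    ∑ k, (U.transpose.mulVec w k) ^ 2 = ∑ k, w k ^ 2 := by
  have h := dotProduct_mulVec_of_diagonalization (A := 1) (e := fun _ => 1) (U := U)
    (by rw [Matrix.diagonal_one, mul_one, hU]) w
  simp only [Matrix.one_mulVec, one_mul] at h
  rw [← h, dotProduct]
  exact Finset.sum_congr rfl fun k _ => by ring

/-- Weyl's inequality under a finite rank perturbation: if, up to a permutation `σ` of the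
coordinates, `B - A ≥ c` off a set of `r` coordinates, then the eigenvalues of `B` dominate
those of `A + c` after a shift of the index by `r`. -/
theorem eigenvalue_le_of_entries {n r : ℕ} {A U B V : Matrix (Fin n) (Fin n) ℝ}
    {a b : Fin n → ℝ} (ha : Monotone a) (hb : Monotone b)
    (hU : U * U.transpose = 1) (hA : A = U * Matrix.diagonal a * U.transpose)
    (hV : V * V.transpose = 1) (hB : B = V * Matrix.diagonal b * V.transpose)
    (σ : Equiv.Perm (Fin n)) (X : Finset (Fin n)) (hX : X.card ≤ r) (c : ℝ)
    (hoff : ∀ m ∉ X, ∀ m' ∉ X, m ≠ m' → A (σ m) (σ m') = B m m')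
    (hdiag : ∀ m ∉ X, A (σ m) (σ m) + c ≤ B m m)
    (i j : Fin n) (hij : (i : ℕ) + r ≤ j) : a i + c ≤ b j := by
  -- The test vector must be orthogonal (after relabelling by `σ`) to the eigenvectors of `A` below
  -- `i`, orthogonal to those of `B` above `j`, and zero on `X`. That is at most i + (n − 1 − j) + r
  -- < n conditions.
  let L₁ : (Fin n → ℝ) →ₗ[ℝ] ({k // k < i} → ℝ) :=
    LinearMap.funLeft ℝ ℝ Subtype.val ∘ₗ U.transpose.mulVecLin ∘ₗ LinearMap.funLeft ℝ ℝ σ.symm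
  let L₂ : (Fin n → ℝ) →ₗ[ℝ] ({k // j < k} → ℝ) :=
    LinearMap.funLeft ℝ ℝ Subtype.val ∘ₗ V.transpose.mulVecLin
  let L₃ : (Fin n → ℝ) →ₗ[ℝ] ({k // k ∈ X} → ℝ) := LinearMap.funLeft ℝ ℝ Subtype.val
  have hker : LinearMap.ker (L₁.prod (L₂.prod L₃)) ≠ ⊥ := by
    apply LinearMap.ker_ne_bot_of_finrank_lt
    rw [Module.finrank_prod, Module.finrank_prod]
    simp only [Module.finrank_fintype_fun_eq_card, Fintype.card_coe, Fintype.card_fin]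
    have h1 : Fintype.card {k : Fin n // k < i} = i := by
      rw [Fintype.card_subtype, Finset.filter_gt_eq_Iio, Fin.card_Iio]
    have h2 : Fintype.card {k : Fin n // j < k} = n - 1 - j := by
      rw [Fintype.card_subtype, Finset.filter_lt_eq_Ioi, Fin.card_Ioi]
    rw [h1, h2]
    have := j.2
    omega
  obtain ⟨w, hw, hw0⟩ := (Submodule.ne_bot_iff _).1 hker
  have hw' := LinearMap.mem_ker.1 hw
  have h1 : L₁ w = 0 := congrArg Prod.fst hw'
  have h2 : L₂ w = 0 := congrArg (fun z => z.2.1) hw'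
  have h3 : L₃ w = 0 := congrArg (fun z => z.2.2) hw'
  have h1 : ∀ k < i, U.transpose.mulVec (w ∘ σ.symm) k = 0 := fun k hk => congrFun h1 ⟨k, hk⟩
  have h2 : ∀ k > j, V.transpose.mulVec w k = 0 := fun k hk => congrFun h2 ⟨k, hk⟩
  have h3 : ∀ k ∈ X, w k = 0 := fun k hk => congrFun h3 ⟨k, hk⟩
  have hpos : 0 < ∑ k, w k ^ 2 := by
    obtain ⟨k, hk⟩ := Function.ne_iff.1 hw0
    exact Finset.sum_pos' (fun _ _ => sq_nonneg _) ⟨k, Finset.mem_univ _, by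
      have : w k ≠ 0 := hk
      positivity⟩
  have hlow : a i * ∑ k, w k ^ 2 ≤ (w ∘ σ.symm) ⬝ᵥ A.mulVec (w ∘ σ.symm) := by
    rw [dotProduct_mulVec_of_diagonalization hA]
    have : ∑ k, w k ^ 2 = ∑ k, (w ∘ σ.symm) k ^ 2 :=
      (Equiv.sum_comp σ.symm (fun k => w k ^ 2)).symm
    rw [this, ← sum_sq_of_orthogonal hU, Finset.mul_sum]
    refine Finset.sum_le_sum fun k _ => ?_
    by_cases hk : k < i
    · rw [h1 k hk]; simp
    · exact mul_le_mul_of_nonneg_right (ha (not_lt.1 hk)) (sq_nonneg _)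
  have hup : w ⬝ᵥ B.mulVec w ≤ b j * ∑ k, w k ^ 2 := by
    rw [dotProduct_mulVec_of_diagonalization hB, ← sum_sq_of_orthogonal hV w, Finset.mul_sum]
    refine Finset.sum_le_sum fun k _ => ?_
    by_cases hk : j < k
    · rw [h2 k hk]; simp
    · exact mul_le_mul_of_nonneg_right (hb (not_lt.1 hk)) (sq_nonneg _)
  have hmid : (w ∘ σ.symm) ⬝ᵥ A.mulVec (w ∘ σ.symm) + c * ∑ k, w k ^ 2 ≤ w ⬝ᵥ B.mulVec w := by
    have e1 : (w ∘ σ.symm) ⬝ᵥ A.mulVec (w ∘ σ.symm) =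
        ∑ m, ∑ m', w m * A (σ m) (σ m') * w m' := by
      rw [dotProduct, ← Equiv.sum_comp σ]
      refine Finset.sum_congr rfl fun m _ => ?_
      rw [Matrix.mulVec, dotProduct, ← Equiv.sum_comp σ, Finset.mul_sum]
      refine Finset.sum_congr rfl fun m' _ => ?_
      simp only [Function.comp_apply, Equiv.symm_apply_apply]
      ring
    have e2 : w ⬝ᵥ B.mulVec w = ∑ m, ∑ m', w m * B m m' * w m' := by
      simp only [dotProduct, Matrix.mulVec, Finset.mul_sum, mul_assoc]
    have e3 : c * ∑ k, w k ^ 2 = ∑ m, ∑ m', if m = m' then c * w m ^ 2 else 0 := by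
      simp [Finset.mul_sum]
    rw [e1, e2, e3, ← Finset.sum_add_distrib]
    refine Finset.sum_le_sum fun m _ => ?_
    rw [← Finset.sum_add_distrib]
    refine Finset.sum_le_sum fun m' _ => ?_
    by_cases hm : m ∈ X
    · simp [h3 m hm]
    by_cases hm' : m' ∈ X
    · have := h3 m' hm'
      split_ifs with h
      · subst h; simp [this]
      · simp [this]
    split_ifs with h
    · subst h
      nlinarith [hdiag m hm, sq_nonneg (w m)]
    · rw [hoff m hm m' hm' h]; simp
  have : (a i + c) * ∑ k, w k ^ 2 ≤ b j * ∑ k, w k ^ 2 := by linarith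
  exact le_of_mul_le_mul_right this hpos

theorem exists_nat_lt_iff_neg {n : ℕ} {a : Fin n → ℝ} (ha : Monotone a) :
    ∃ k : ℕ, ∀ j : Fin n, (j : ℕ) < k ↔ a j < 0 := by
  classical
  have hex : ∃ k : ℕ, ∀ j : Fin n, k ≤ j → 0 ≤ a j := ⟨n, fun j hj => absurd j.2 (by omega)⟩
  refine ⟨Nat.find hex, fun j => ⟨fun hj => ?_, fun hj => ?_⟩⟩
  · have := Nat.find_min hex hj
    push Not at this
    obtain ⟨j', hj', h⟩ := this
    exact (ha (show j ≤ j' from hj')).trans_lt h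
  · by_contra h
    exact absurd (Nat.find_spec hex j (not_lt.1 h)) (not_le.2 hj)

/-- If two nondecreasing finite sequences interlace up to an index shift by `r`, the products of
their absolute values are comparable when one of them stays away from `0`. -/
theorem prod_abs_le_of_interlace {n r : ℕ} {a b : Fin n → ℝ} (ha : Monotone a)
    (hab : ∀ i j : Fin n, (i : ℕ) + r ≤ j → a i ≤ b j ∧ b i ≤ a j) {R η : ℝ} (hR : 1 ≤ R)
    (hb : ∀ j, |b j| ≤ R) (hη : 0 < η) (hη1 : η ≤ 1) (haη : ∀ j, η ≤ |a j|) :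
    (∏ j, |b j|) * η ^ (4 * r) ≤ R ^ (4 * r) * ∏ j, |a j| := by
  classical
  obtain ⟨k, hk⟩ := exists_nat_lt_iff_neg ha
  -- With `k` the number of negative `a j`, indices at distance from `k` have `b j` of known sign,
  -- so |b j| is bounded by |a| at an index shifted by `r` away from `k`. Discarded are `r` indices
  -- at each end and `2 * r` around `k`, hence the exponent `4 * r`.
  let G : Finset (Fin n) := Finset.univ.filter fun j =>
    (r ≤ (j : ℕ) ∧ (j : ℕ) + r < n) ∧ (k + r ≤ j ∨ (j : ℕ) + r < k)
  have hn : ∀ j : Fin n, (j : ℕ) - r < n := fun j => (Nat.sub_le _ _).trans_lt j.2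
  let τ : Fin n → Fin n := fun j =>
    if k + r ≤ j then (if h : (j : ℕ) + r < n then ⟨j + r, h⟩ else j) else ⟨j - r, hn j⟩
  have hτup : ∀ j ∈ G, k + r ≤ j → (τ j : ℕ) = j + r := by
    intro j hj h
    have hj := (Finset.mem_filter.1 hj).2
    simp [τ, h, hj.1.2]
  have hτdn : ∀ j ∈ G, ¬ k + r ≤ j → (τ j : ℕ) = j - r := by
    intro j hj h
    simp [τ, h]
  have hinj : Set.InjOn τ G := by
    intro j hj j' hj' h
    have h := congrArg Fin.val h
    have h1 := (Finset.mem_filter.1 hj).2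
    have h2 := (Finset.mem_filter.1 hj').2
    apply Fin.ext
    by_cases c1 : k + r ≤ j <;> by_cases c2 : k + r ≤ j'
    · rw [hτup j hj c1, hτup j' hj' c2] at h; omega
    · rw [hτup j hj c1, hτdn j' hj' c2] at h; omega
    · rw [hτdn j hj c1, hτup j' hj' c2] at h; omega
    · rw [hτdn j hj c1, hτdn j' hj' c2] at h; omega
  have hle : ∀ j ∈ G, |b j| ≤ |a (τ j)| := by
    intro j hj
    have h1 := (Finset.mem_filter.1 hj).2
    by_cases c1 : k + r ≤ j
    · have hv := hτup j hj c1
      have u := (hab j (τ j) (by omega)).2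
      have l := (hab ⟨j - r, hn j⟩ j (by simp only; omega)).1
      have p : 0 ≤ a ⟨j - r, hn j⟩ := by
        by_contra h
        have := (hk _).2 (not_le.1 h)
        simp only at this; omega
      rw [abs_of_nonneg (p.trans l), abs_of_nonneg (p.trans (l.trans u))]
      exact u
    · have hv := hτdn j hj c1
      have u := (hab (τ j) j (by omega)).1
      have l := (hab j ⟨j + r, h1.1.2⟩ (by simp)).2
      have p : a ⟨j + r, h1.1.2⟩ < 0 := (hk _).1 (by simp only; omega)
      rw [abs_of_nonpos (l.trans p.le), abs_of_nonpos (u.trans (l.trans p.le))]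
      linarith
  have hGc : Gᶜ.card ≤ 4 * r := by
    have hsub : Gᶜ.image Fin.val ⊆ Finset.range r ∪ (Finset.Ico (n - r) n ∪
        Finset.Ico (k - r) (k + r)) := by
      intro m hm
      obtain ⟨j, hj, rfl⟩ := Finset.mem_image.1 hm
      have hj : ¬ ((r ≤ (j : ℕ) ∧ (j : ℕ) + r < n) ∧ (k + r ≤ j ∨ (j : ℕ) + r < k)) := by
        simpa [G] using hj
      have := j.2
      simp only [Finset.mem_union, Finset.mem_range, Finset.mem_Ico]
      omega
    have h1 := Finset.card_le_card hsub
    rw [Finset.card_image_of_injective _ Fin.val_injective] at h1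
    have h2 := Finset.card_union_le (Finset.range r) (Finset.Ico (n - r) n ∪
        Finset.Ico (k - r) (k + r))
    have h3 := Finset.card_union_le (Finset.Ico (n - r) n) (Finset.Ico (k - r) (k + r))
    simp only [Finset.card_range, Nat.card_Ico] at h1 h2 h3
    omega
  have hcard : (G.image τ)ᶜ.card = Gᶜ.card := by
    rw [Finset.card_compl, Finset.card_compl, Finset.card_image_of_injOn hinj]
  have hb1 : ∏ j, |b j| ≤ (∏ j ∈ G, |a (τ j)|) * R ^ (4 * r) := by
    rw [← Finset.prod_mul_prod_compl G]
    refine mul_le_mul (Finset.prod_le_prod (fun _ _ => abs_nonneg _) hle) ?_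
      (Finset.prod_nonneg fun _ _ => abs_nonneg _) (Finset.prod_nonneg fun _ _ => abs_nonneg _)
    refine (Finset.prod_le_prod (fun _ _ => abs_nonneg _) (fun j _ => hb j)).trans ?_
    rw [Finset.prod_const]
    exact pow_le_pow_right₀ hR hGc
  have ha1 : (∏ j ∈ G, |a (τ j)|) * η ^ (4 * r) ≤ ∏ j, |a j| := by
    rw [← Finset.prod_mul_prod_compl (G.image τ) (fun j => |a j|),
      Finset.prod_image hinj]
    refine mul_le_mul_of_nonneg_left ?_ (Finset.prod_nonneg fun _ _ => abs_nonneg _)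
    refine le_trans ?_ (Finset.prod_le_prod (fun _ _ => hη.le) (fun j _ => haη j))
    rw [Finset.prod_const, hcard]
    exact pow_le_pow_of_le_one hη.le hη1 hGc
  have hηp := pow_pos hη (4 * r)
  have hRp : 0 < R ^ (4 * r) := pow_pos (by linarith) _
  nlinarith [mul_le_mul_of_nonneg_right hb1 hηp.le, mul_le_mul_of_nonneg_left ha1 hRp.le]

/-- Every eigenvalue of a real symmetric matrix is bounded by the maximal absolute row sum. -/
theorem abs_eigenvalue_le_of_row_sum {n : ℕ} {A U : Matrix (Fin n) (Fin n) ℝ} {e : Fin n → ℝ}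
    (hU : U * U.transpose = 1) (hA : A = U * Matrix.diagonal e * U.transpose) {R : ℝ}
    (hR : ∀ i, ∑ j, |A i j| ≤ R) (k : Fin n) : |e k| ≤ R := by
  have hU' : U.transpose * U = 1 := mul_eq_one_comm.1 hU
  have hAU : A * U = U * Matrix.diagonal e := by
    rw [hA, Matrix.mul_assoc, hU', Matrix.mul_one]
  -- Gershgorin's argument: read the eigenvalue equation in the row where the eigenvector is
  -- largest.
  obtain ⟨m, -, hm⟩ := Finset.exists_max_image Finset.univ (fun m => |U m k|) ⟨k, Finset.mem_univ _⟩
  have hne : 0 < |U m k| := by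
    rcases (abs_nonneg (U m k)).lt_or_eq with h | h
    · exact h
    · exfalso
      have h1 := congrFun (congrFun hU' k) k
      rw [Matrix.mul_apply, Matrix.one_apply_eq] at h1
      rw [Finset.sum_eq_zero] at h1
      · exact zero_ne_one h1
      · intro m' _
        have := hm m' (Finset.mem_univ _)
        rw [← h] at this
        rw [abs_nonpos_iff.1 this, mul_zero]
  have h1 := congrFun (congrFun hAU m) k
  rw [Matrix.mul_diagonal, Matrix.mul_apply] at h1
  have h2 : |U m k| * |e k| ≤ |U m k| * R := by
    rw [← abs_mul, ← h1]
    refine (Finset.abs_sum_le_sum_abs _ _).trans ?_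
    refine le_trans ?_ (mul_le_mul_of_nonneg_left (hR m) hne.le)
    rw [Finset.mul_sum]
    refine Finset.sum_le_sum fun j _ => ?_
    rw [abs_mul, mul_comm]
    exact mul_le_mul_of_nonneg_right (hm j (Finset.mem_univ _)) (abs_nonneg _)
  exact le_of_mul_le_mul_left h2 hne

/-! ### Jacobi determinants and transfer matrices. -/

/-- The `n × n` Jacobi matrix with diagonal `c` and constant off-diagonal entries `s`. -/
def jacobi (s : ℝ) (c : ℕ → ℝ) (n : ℕ) : Matrix (Fin n) (Fin n) ℝ :=
  Matrix.of fun i j =>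
    if i = j then c i else if (i : ℕ) + 1 = j ∨ (j : ℕ) + 1 = i then s else 0

/-- The product of the one-step matrices with coefficients `c (n-1), …, c 0`. -/
def cocycle (c : ℕ → ℝ) : ℕ → Matrix (Fin 2) (Fin 2) ℝ
  | 0 => 1
  | n + 1 => !![c n, -1; 1, 0] * cocycle c n

theorem transferMatrix_eq_cocycle (α lam : ℝ) (v : ℝ → ℝ) (x E : ℝ) (n : ℕ) :
    transferMatrix α lam v x E n = cocycle (fun m => E - lam * v (x + m * α)) n := by
  induction n with
  | zero => rfl
  | succ n ih => rw [transferMatrix, cocycle, ih]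

theorem jacobi_isSymm (s : ℝ) (c : ℕ → ℝ) (n : ℕ) : (jacobi s c n).IsSymm := by
  ext i j
  simp only [jacobi, Matrix.transpose_apply, Matrix.of_apply, eq_comm (a := j) (b := i), or_comm]
  split_ifs with h
  · rw [h]
  · rfl
  · rfl

theorem cocycle_succ' (c : ℕ → ℝ) (n : ℕ) :
    cocycle c (n + 1) = cocycle (fun m => c (m + 1)) n * !![c 0, -1; 1, 0] := by
  induction n with
  | zero => simp [cocycle]
  | succ n ih => rw [cocycle, ih, cocycle, Matrix.mul_assoc]

theorem cocycle_congr {c c' : ℕ → ℝ} {n : ℕ} (h : ∀ m < n, c m = c' m) :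
    cocycle c n = cocycle c' n := by
  induction n with
  | zero => rfl
  | succ n ih => rw [cocycle, cocycle, h n (by omega), ih fun m hm => h m (by omega)]

theorem det_jacobi_succ_succ (s : ℝ) (c : ℕ → ℝ) (n : ℕ) :
    (jacobi s c (n + 2)).det = c 0 * (jacobi s (fun m => c (m + 1)) (n + 1)).det -
      s ^ 2 * (jacobi s (fun m => c (m + 2)) n).det := by
  have hA : (jacobi s c (n + 2)).submatrix Fin.succ Fin.succ =
      jacobi s (fun m => c (m + 1)) (n + 1) := by
    ext i j
    simp [jacobi]
  have hB : ((jacobi s c (n + 2)).submatrix Fin.succ (Fin.succAbove 1)).det =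
      s * (jacobi s (fun m => c (m + 2)) n).det := by
    rw [Matrix.det_succ_column_zero, Fin.sum_univ_succ, Finset.sum_eq_zero]
    · have : (((jacobi s c (n + 2)).submatrix Fin.succ (Fin.succAbove 1)).submatrix
          (Fin.succAbove 0) Fin.succ) = jacobi s (fun m => c (m + 2)) n := by
        ext i j
        have h : Fin.succAbove (1 : Fin (n + 2)) j.succ = j.succ.succ :=
          Fin.succAbove_of_lt_succ _ _ (by simp [Fin.lt_def])
        simp [jacobi, h]
      rw [this]
      have h0 : Fin.succAbove (1 : Fin (n + 2)) 0 = 0 := by simp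
      simp [jacobi, h0]
    · intro i _
      have h0 : Fin.succAbove (1 : Fin (n + 2)) 0 = 0 := by simp
      have : ((jacobi s c (n + 2)).submatrix Fin.succ (Fin.succAbove 1)) i.succ 0 = 0 := by
        simp [jacobi, h0, Fin.ext_iff]
      rw [this]; simp
  rw [Matrix.det_succ_row_zero, Fin.sum_univ_succ, Fin.sum_univ_succ, Finset.sum_eq_zero]
  · rw [Fin.succAbove_zero, hA, Fin.succ_zero_eq_one, hB]
    simp [jacobi]
    ring
  · intro i _
    have : jacobi s c (n + 2) 0 i.succ.succ = 0 := by
      simp [jacobi, Fin.ext_iff]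
    rw [this]; simp

theorem cocycle_zero_zero_rec (c : ℕ → ℝ) (n : ℕ) :
    cocycle c (n + 2) 0 0 = c 0 * cocycle (fun m => c (m + 1)) (n + 1) 0 0 -
      cocycle (fun m => c (m + 2)) n 0 0 := by
  rw [cocycle_succ' c (n + 1), cocycle_succ' (fun m => c (m + 1)) n]
  simp [Matrix.mul_apply, Fin.sum_univ_two]
  ring

/-- The off-diagonal entries enter the three-term recurrence only through their square, so both
signs give the same determinant. -/
theorem det_jacobi (s : ℝ) (hs : s ^ 2 = 1) (n : ℕ) (c : ℕ → ℝ) :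
    (jacobi s c n).det = cocycle c n 0 0 := by
  induction n using Nat.strong_induction_on generalizing c with
  | _ n ih =>
    match n with
    | 0 => simp [cocycle]
    | 1 => simp [cocycle, jacobi]
    | n + 2 =>
      rw [det_jacobi_succ_succ, cocycle_zero_zero_rec, ih _ (by omega), ih _ (by omega), hs, one_mul]

/-- The sign `s` is free at the level of absolute values. It is later chosen to make the diagonal of
s(H − E) increasing in v for either sign of the coupling. -/
theorem abs_det_jacobi_neg_mul (s : ℝ) (hs : s ^ 2 = 1) (n : ℕ) (c : ℕ → ℝ) :
    |(jacobi s (fun m => -(s * c m)) n).det| = |cocycle c n 0 0| := by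
  have h : jacobi s (fun m => -(s * c m)) n = (-s) • jacobi (-1) c n := by
    ext i j
    simp only [jacobi, Matrix.smul_apply, Matrix.of_apply, smul_eq_mul]
    split_ifs <;> ring
  have hs' : |s| = 1 := by
    rw [← abs_of_pos one_pos]
    exact sq_eq_sq_iff_abs_eq_abs _ _ |>.1 (by rw [hs]; norm_num)
  rw [h, Matrix.det_smul, det_jacobi (-1) (by norm_num), abs_mul, abs_pow, abs_neg, hs', one_pow,
    one_mul]

theorem abs_dirichletDet (α lam : ℝ) (v : ℝ → ℝ) (n : ℕ) (x E : ℝ) :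
    |dirichletDet α lam v n x E| = |cocycle (fun m => E - lam * v (x + m * α)) n 0 0| := by
  rw [← abs_det_jacobi_neg_mul 1 (by norm_num), dirichletDet]
  congr 2
  ext i j
  simp only [dirichletMatrix, schrodingerOp, jacobi, Matrix.sub_apply, Matrix.of_apply,
    Matrix.smul_apply, Matrix.one_apply, Pi.single_apply, smul_eq_mul, Fin.ext_iff]
  by_cases h : (i : ℕ) = j
  · have h1 : ¬ ((i : ℤ) + 1 = j) := by omega
    have h2 : ¬ ((i : ℤ) - 1 = j) := by omega
    have h3 : (i : ℤ) = j := by omega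
    simp [h]
  · have h3 : ¬ ((i : ℤ) = j) := by omega
    by_cases h1 : (i : ℕ) + 1 = j
    · have h1' : (i : ℤ) + 1 = j := by omega
      have h2' : ¬ ((i : ℤ) - 1 = j) := by omega
      rw [if_pos h1', if_neg h2', if_neg h3, if_neg h, if_neg h, if_pos (Or.inl h1)]; ring
    · have h1' : ¬ ((i : ℤ) + 1 = j) := by omega
      by_cases h2 : (j : ℕ) + 1 = i
      · have h2' : ((i : ℤ) - 1 = j) := by omega
        rw [if_neg h1', if_pos h2', if_neg h3, if_neg h, if_neg h, if_pos (Or.inr h2)]; ring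
      · have h2' : ¬ ((i : ℤ) - 1 = j) := by omega
        rw [if_neg h1', if_neg h2', if_neg h3, if_neg h, if_neg h, if_neg (by tauto)]; ring

theorem det_cocycle (c : ℕ → ℝ) (n : ℕ) : (cocycle c n).det = 1 := by
  induction n with
  | zero => simp [cocycle]
  | succ n ih => rw [cocycle, Matrix.det_mul, ih, Matrix.det_fin_two]; simp

theorem norm_toEuclideanCLM_le {M : Matrix (Fin 2) (Fin 2) ℝ} {K : ℝ}
    (h : ∀ i j, |M i j| ≤ K) : ‖Matrix.toEuclideanCLM (𝕜 := ℝ) M‖ ≤ 2 * K := by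
  have hK : 0 ≤ K := (abs_nonneg _).trans (h 0 0)
  refine ContinuousLinearMap.opNorm_le_bound _ (by linarith) fun w => ?_
  refine le_of_sq_le_sq ?_ (by positivity)
  rw [mul_pow, EuclideanSpace.real_norm_sq_eq, EuclideanSpace.real_norm_sq_eq]
  simp only [Fin.sum_univ_two, Matrix.ofLp_toEuclideanCLM, Matrix.mulVec, dotProduct]
  have hsq : ∀ i j, M i j ^ 2 ≤ K ^ 2 := fun i j => sq_le_sq' (abs_le.1 (h i j)).1 (abs_le.1 (h i j)).2
  have key : ∀ i, (M i 0 * w 0 + M i 1 * w 1) ^ 2 ≤ 2 * K ^ 2 * (w 0 ^ 2 + w 1 ^ 2) := by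
    intro i
    nlinarith [sq_nonneg (M i 0 * w 0 - M i 1 * w 1), mul_le_mul_of_nonneg_right (hsq i 0)
      (sq_nonneg (w 0)), mul_le_mul_of_nonneg_right (hsq i 1) (sq_nonneg (w 1))]
  nlinarith [key 0, key 1]

/-- Hadamard's inequality: the determinant is at most the product of the column lengths, and each
column length is at most the norm. -/
theorem one_le_norm_toEuclideanCLM {M : Matrix (Fin 2) (Fin 2) ℝ} (h : M.det = 1) :
    1 ≤ ‖Matrix.toEuclideanCLM (𝕜 := ℝ) M‖ := by
  set N := ‖Matrix.toEuclideanCLM (𝕜 := ℝ) M‖ with hN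
  have hN0 : 0 ≤ N := norm_nonneg _
  have col : ∀ j, M 0 j ^ 2 + M 1 j ^ 2 ≤ N ^ 2 := by
    intro j
    have h1 := (Matrix.toEuclideanCLM (𝕜 := ℝ) M).le_opNorm (EuclideanSpace.single j (1 : ℝ))
    rw [PiLp.norm_single, norm_one, mul_one] at h1
    have h2 := pow_le_pow_left₀ (norm_nonneg _) h1 2
    rw [EuclideanSpace.real_norm_sq_eq] at h2
    simpa [Fin.sum_univ_two, Matrix.ofLp_toEuclideanCLM] using h2
  rw [Matrix.det_fin_two] at h
  have h1 := col 0
  have h2 := col 1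
  have h3 : (M 0 0 ^ 2 + M 1 0 ^ 2) * (M 0 1 ^ 2 + M 1 1 ^ 2) ≤ N ^ 2 * N ^ 2 :=
    mul_le_mul h1 h2 (by positivity) (by positivity)
  have h4 : 1 ≤ (M 0 0 ^ 2 + M 1 0 ^ 2) * (M 0 1 ^ 2 + M 1 1 ^ 2) := by
    have : (M 0 0 ^ 2 + M 1 0 ^ 2) * (M 0 1 ^ 2 + M 1 1 ^ 2) =
      (M 0 0 * M 1 1 - M 0 1 * M 1 0) ^ 2 + (M 0 0 * M 0 1 + M 1 0 * M 1 1) ^ 2 := by ring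
    rw [this, h]; nlinarith [sq_nonneg (M 0 0 * M 0 1 + M 1 0 * M 1 1)]
  by_contra hlt
  push Not at hlt
  have : N ^ 2 < 1 := by nlinarith
  nlinarith [sq_nonneg N]

/-- Changing the first and the last coefficient of the cocycle reads off all of its entries. -/
theorem cocycle_boundary (c : ℕ → ℝ) (n : ℕ) (τ τ' : ℝ) :
    cocycle (fun m => c m - (if m = n + 1 then τ else 0) - (if m = 0 then τ' else 0)) (n + 2) 0 0 =
      (cocycle c (n + 2) 0 0 + τ' * cocycle c (n + 2) 0 1) -
        τ * (cocycle c (n + 2) 1 0 + τ' * cocycle c (n + 2) 1 1) := by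
  have h : ∀ c : ℕ → ℝ, cocycle c (n + 2) = !![c (n + 1), -1; 1, 0] *
      cocycle (fun m => c (m + 1)) n * !![c 0, -1; 1, 0] := by
    intro c
    rw [cocycle, cocycle_succ', Matrix.mul_assoc]
  rw [h, h c]
  have h' : cocycle (fun m => (fun m => c m - (if m = n + 1 then τ else 0) -
      (if m = 0 then τ' else 0)) (m + 1)) n = cocycle (fun m => c (m + 1)) n :=
    cocycle_congr fun m hm => by
      have : m ≠ n := by omega
      simp [this]
  rw [h']
  simp [Matrix.mul_apply, Fin.sum_univ_two, Matrix.vecMul, dotProduct]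
  ring

/-- The four choices τ, τ' ∈ {0, 1} determine all entries. If every resulting determinant were below
N/8, where N is the norm, the entries would be below N/2, contradicting the bound of the norm by
twice the largest entry. -/
theorem exists_boundary_norm_le (c : ℕ → ℝ) (n : ℕ) :
    ∃ τ ∈ Set.Icc (0 : ℝ) 1, ∃ τ' ∈ Set.Icc (0 : ℝ) 1,
      ‖Matrix.toEuclideanCLM (𝕜 := ℝ) (cocycle c (n + 2))‖ ≤ 8 * |cocycle (fun m => c m -
        (if m = n + 1 then τ else 0) - (if m = 0 then τ' else 0)) (n + 2) 0 0| := by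
  by_contra hcon
  push Not at hcon
  have h00 := hcon 0 (by simp) 0 (by simp)
  have h01 := hcon 0 (by simp) 1 (by simp)
  have h10 := hcon 1 (by simp) 0 (by simp)
  have h11 := hcon 1 (by simp) 1 (by simp)
  rw [cocycle_boundary] at h00 h01 h10 h11
  set M := cocycle c (n + 2)
  set N := ‖Matrix.toEuclideanCLM (𝕜 := ℝ) M‖ with hN
  have hb : ∃ K, K < N ∧ ∀ i j, |M i j| ≤ K / 2 := by
    have a0 : |M 0 0| < N / 8 := by
      have : M 0 0 + 0 * M 0 1 - 0 * (M 1 0 + 0 * M 1 1) = M 0 0 := by ring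
      rw [this] at h00; linarith
    have a1 : |M 0 0 + M 0 1| < N / 8 := by
      have : M 0 0 + 1 * M 0 1 - 0 * (M 1 0 + 1 * M 1 1) = M 0 0 + M 0 1 := by ring
      rw [this] at h01; linarith
    have a2 : |M 0 0 - M 1 0| < N / 8 := by
      have : M 0 0 + 0 * M 0 1 - 1 * (M 1 0 + 0 * M 1 1) = M 0 0 - M 1 0 := by ring
      rw [this] at h10; linarith
    have a3 : |M 0 0 + M 0 1 - M 1 0 - M 1 1| < N / 8 := by
      have : M 0 0 + 1 * M 0 1 - 1 * (M 1 0 + 1 * M 1 1) = M 0 0 + M 0 1 - M 1 0 - M 1 1 := by ring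
      rw [this] at h11; linarith
    rw [abs_lt] at a0 a1 a2 a3
    refine ⟨2 * max (max |M 0 0| |M 0 1|) (max |M 1 0| |M 1 1|), ?_, ?_⟩
    · have : max (max |M 0 0| |M 0 1|) (max |M 1 0| |M 1 1|) < N / 2 := by
        refine max_lt (max_lt ?_ ?_) (max_lt ?_ ?_) <;> rw [abs_lt] <;> constructor <;> linarith
      linarith
    · rw [mul_div_cancel_left₀ _ (two_ne_zero)]
      intro i j
      fin_cases i <;> fin_cases j <;> simp
  obtain ⟨K, hK, hM⟩ := hb
  have := norm_toEuclideanCLM_le hM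
  linarith

/-! ### Approximation by continued fraction convergents. -/

theorem exists_int_contsAux (α : ℝ) (n : ℕ) :
    ∃ a b : ℤ, (GenContFract.of α).contsAux n = ⟨(a : ℝ), (b : ℝ)⟩ := by
  induction n using Nat.strong_induction_on with
  | _ n ih =>
    match n with
    | 0 => exact ⟨1, 0, by simp⟩
    | 1 => exact ⟨⌊α⌋, 1, by simp [GenContFract.first_contAux_eq_h_one]⟩
    | n + 2 =>
      obtain ⟨a, b, h⟩ := ih n (by omega)
      obtain ⟨a', b', h'⟩ := ih (n + 1) (by omega)
      cases hs : (GenContFract.of α).s.get? n with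
      | none =>
        exact ⟨a', b', by rw [GenContFract.contsAux_stable_step_of_terminated hs, h']⟩
      | some gp =>
        obtain ⟨h1, z, hz⟩ := GenContFract.of_partNum_eq_one_and_exists_int_partDen_eq hs
        refine ⟨z * a' + a, z * b' + b, ?_⟩
        rw [GenContFract.contsAux_recurrence hs h h', h1, hz]
        push_cast
        simp

/-- The continuants are integers, so the reduced denominator divides the continuant. This inequality
is enough to express the approximation bound through `cfDen`. -/
theorem cfDen_le_dens (α : ℝ) (n : ℕ) (hpos : 0 < (GenContFract.of α).dens n) :
    (cfDen α n : ℝ) ≤ (GenContFract.of α).dens n := by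
  obtain ⟨a, b, h⟩ := exists_int_contsAux α (n + 1)
  have ha : (GenContFract.of α).nums n = a := by
    rw [GenContFract.num_eq_conts_a, GenContFract.nth_cont_eq_succ_nth_contAux, h]
  have hb : (GenContFract.of α).dens n = b := by
    rw [GenContFract.den_eq_conts_b, GenContFract.nth_cont_eq_succ_nth_contAux, h]
  have hc := Real.convs_eq_convergent α n
  rw [GenContFract.conv_eq_num_div_den, ha, hb] at hc
  have hc' : α.convergent n = (a : ℚ) / b := by exact_mod_cast hc.symm
  rw [hb] at hpos ⊢
  have hb0 : 0 < b := by exact_mod_cast hpos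
  have hd : ((α.convergent n).den : ℤ) ∣ b := by
    rw [hc', ← Rat.divInt_eq_div]; exact Rat.den_dvd a b
  exact_mod_cast Int.le_of_dvd hb0 hd

theorem abs_sub_convergent_le_one_div_cfDen_sq (α : ℝ) (hα : Irrational α) (n : ℕ) :
    |α - (α.convergent n : ℝ)| ≤ 1 / (cfDen α n : ℝ) ^ 2 := by
  have hterm : ∀ k, ¬ (GenContFract.of α).TerminatedAt k := fun k hk => by
    obtain ⟨r, hr⟩ := (GenContFract.terminates_iff_rat α).1 ⟨k, hk⟩
    exact hα ⟨r, hr.symm⟩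
  have hd : 0 < (GenContFract.of α).dens n := by
    have h := GenContFract.succ_nth_fib_le_of_nth_den (v := α) (n := n) (Or.inr (hterm _))
    have : 0 < Nat.fib (n + 1) := Nat.fib_pos.2 (by omega)
    exact lt_of_lt_of_le (by exact_mod_cast this) h
  have h := GenContFract.abs_sub_convs_le (hterm n)
  rw [Real.convs_eq_convergent] at h
  have hle := cfDen_le_dens α n hd
  have hq : (0 : ℝ) < cfDen α n := by exact_mod_cast (α.convergent n).den_pos
  refine h.trans (one_div_le_one_div_of_le (by positivity) ?_)
  rw [sq]
  exact mul_le_mul hle (hle.trans GenContFract.of_den_mono) hq.le hd.le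

/-! ### Orbits of the rotation over one good period. -/

/-- The fraction `p / q` in lowest terms approximates `α` to order `1 / q ^ 2`. -/
structure IsGoodApprox (α : ℝ) (p : ℤ) (q : ℕ) : Prop where
  pos : 0 < q
  coprime : IsCoprime p (q : ℤ)
  abs_le : |q * α - p| ≤ 1 / q

theorem isGoodApprox_cfDen (α : ℝ) (hα : Irrational α) (n : ℕ) :
    IsGoodApprox α (α.convergent n).num (cfDen α n) := by
  have hpos : 0 < cfDen α n := (α.convergent n).den_pos
  refine ⟨hpos, ?_, ?_⟩
  · exact Rat.isCoprime_num_den _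
  · have h := abs_sub_convergent_le_one_div_cfDen_sq α hα n
    have hq : (0 : ℝ) < cfDen α n := by exact_mod_cast hpos
    have e : (α.convergent n : ℝ) = (α.convergent n).num / cfDen α n := by
      exact_mod_cast (Rat.num_div_den (α.convergent n)).symm
    rw [e] at h
    have e2 : (cfDen α n : ℝ) * α - (α.convergent n).num =
        cfDen α n * (α - (α.convergent n).num / cfDen α n) := by field_simp
    rw [e2, abs_mul, abs_of_pos hq]
    calc _ ≤ (cfDen α n : ℝ) * (1 / (cfDen α n : ℝ) ^ 2) := by gcongr
      _ = _ := by field_simp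

theorem IsGoodApprox.mul_lt {α : ℝ} {p : ℤ} {q : ℕ} (h : IsGoodApprox α p q) {m : ℝ}
    (hm : |m| < q) : |m * (q * α - p)| < 1 := by
  have hq : (0 : ℝ) < q := by exact_mod_cast h.pos
  rw [abs_mul]
  calc |m| * |q * α - p| ≤ |m| * (1 / q) := mul_le_mul_of_nonneg_left h.abs_le (abs_nonneg _)
    _ < q * (1 / q) := mul_lt_mul_of_pos_right hm (by positivity)
    _ = 1 := by field_simp

/-- Replacing α by p/q moves no point by more than 1/q. The integers m p − q⌊z + mα⌋ are distinct
mod q because p is invertible, and a fractional part below 3/q confines them to a window of 5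
values. -/
theorem IsGoodApprox.card_fract_lt {α : ℝ} {p : ℤ} {q : ℕ} (h : IsGoodApprox α p q) (z : ℝ) :
    (Finset.univ.filter fun m : Fin q => Int.fract (z + m * α) < 3 / q).card ≤ 5 := by
  have hq : (0 : ℝ) < q := by exact_mod_cast h.pos
  let g : Fin q → ℤ := fun m => m * p - q * ⌊z + m * α⌋
  have hmaps : Set.MapsTo g (Finset.univ.filter fun m : Fin q => Int.fract (z + m * α) < 3 / q)
      (Finset.Icc ⌊-(q * z)⌋ (⌊-(q * z)⌋ + 4) : Finset ℤ) := by
    intro m hm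
    have hm := (Finset.mem_filter.1 hm).2
    have h0 := Int.fract_nonneg (z + m * α)
    rw [lt_div_iff₀ hq] at hm
    have hf : (⌊z + m * α⌋ : ℝ) = z + m * α - Int.fract (z + m * α) := by
      rw [Int.self_sub_fract]
    have h1 := h.mul_lt (m := m) (by
      rw [abs_of_nonneg (by positivity)]; exact_mod_cast m.2)
    rw [abs_lt] at h1
    have hg : (g m : ℝ) = -(q * z) + q * Int.fract (z + m * α) - m * (q * α - p) := by
      simp only [g]; push_cast; rw [hf]; ring
    have h2 := Int.floor_le (-(q * z))
    have h3 := Int.lt_floor_add_one (-(q * z))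
    have h4 : (0 : ℝ) ≤ q * Int.fract (z + m * α) := by positivity
    simp only [Finset.coe_Icc, Set.mem_Icc]
    constructor
    · have : (⌊-(q * z)⌋ : ℝ) < g m + 1 := by rw [hg]; linarith
      exact Int.lt_add_one_iff.1 (by exact_mod_cast this)
    · have : (g m : ℝ) < ⌊-(q * z)⌋ + 4 + 1 := by rw [hg]; linarith
      exact Int.lt_add_one_iff.1 (by exact_mod_cast this)
  have hinj : Set.InjOn g (Finset.univ.filter fun m : Fin q =>
      Int.fract (z + m * α) < 3 / q) := by
    intro m _ m' _ hmm
    simp only [g] at hmm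
    have hd : (q : ℤ) ∣ ((m : ℕ) - (m' : ℕ) : ℤ) * p :=
      ⟨⌊z + m * α⌋ - ⌊z + m' * α⌋, by linear_combination hmm⟩
    have hd' := h.coprime.symm.dvd_of_dvd_mul_right hd
    have := Int.eq_zero_of_abs_lt_dvd hd' (by
      have := m.2
      have := m'.2
      rw [abs_lt]; constructor <;> omega)
    apply Fin.ext
    omega
  have := Finset.card_le_card_of_injOn g hmaps hinj
  rw [Int.card_Icc] at this
  omega

/-- Up to a cyclic shift of the index, the orbit of `y` is a translate by at most `3 / q`
of the orbit of `x`. -/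
theorem IsGoodApprox.exists_shift {α : ℝ} {p : ℤ} {q : ℕ} (h : IsGoodApprox α p q) (x y : ℝ) :
    ∃ σ : Equiv.Perm (Fin q),
      (∃ i : ℕ, ∀ m, (σ m : ℕ) = m + i ∨ (σ m : ℕ) + q = m + i) ∧
      ∀ m : Fin q, ∃ (N : ℤ) (D : ℝ), 0 ≤ D ∧ D ≤ 3 / q ∧
        y + m * α = x + (σ m : ℕ) * α + N + D := by
  have hq : (0 : ℝ) < q := by exact_mod_cast h.pos
  obtain ⟨u, w, huw⟩ := h.coprime
  -- The shift `i` solves i p ≡ a mod q. Then q D is q(y − x) − a, which lies in [1, 2), plus an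
  -- error (m − k)(qα − p) in (−1, 1); subtracting 1 in `a` keeps D nonnegative, and D ≤ 3/q.
  set a : ℤ := ⌊q * (y - x)⌋ - 1 with ha
  have hqz : (0 : ℤ) < q := by exact_mod_cast h.pos
  have hi0 := Int.emod_nonneg (a * u) hqz.ne'
  have hi1 := Int.emod_lt_of_pos (a * u) hqz
  have hi2 := Int.emod_add_mul_ediv (a * u) q
  obtain ⟨i, hi⟩ := Int.eq_ofNat_of_zero_le hi0
  rw [hi] at hi1 hi2
  have hiq : i < q := by exact_mod_cast hi1
  have : NeZero q := ⟨h.pos.ne'⟩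
  have hσ : ∀ m : Fin q, ((m + ⟨i, hiq⟩ : Fin q) : ℕ) = m + i ∨
      ((m + ⟨i, hiq⟩ : Fin q) : ℕ) + q = m + i := by
    intro m
    rw [Fin.val_add]
    have := m.2
    simp only
    by_cases hlt : (m : ℕ) + i < q
    · left; exact Nat.mod_eq_of_lt hlt
    · right
      rw [Nat.mod_eq_sub_mod (by omega), Nat.mod_eq_of_lt (by omega)]
      omega
  refine ⟨Equiv.addRight (⟨i, hiq⟩ : Fin q), ⟨i, hσ⟩, fun m => ?_⟩
  simp only [Equiv.coe_addRight]
  set k : Fin q := m + ⟨i, hiq⟩ with hk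
  have hex : ∃ c : ℤ, (k : ℤ) = m + i - c * q := by
    rcases hσ m with h1 | h1
    · exact ⟨0, by omega⟩
    · exact ⟨1, by omega⟩
  obtain ⟨c, hc⟩ := hex
  have hip : ∃ d : ℤ, (i : ℤ) * p = a + d * q :=
    ⟨-(a * w) - p * ((a * u) / q), by linear_combination a * huw + p * hi2⟩
  obtain ⟨d, hd⟩ := hip
  have hlt := h.mul_lt (m := (m : ℝ) - (k : ℝ)) (by
    have h1 : ((m : ℕ) : ℝ) < q := by exact_mod_cast m.2
    have h2 : ((k : ℕ) : ℝ) < q := by exact_mod_cast k.2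
    have h3 : (0 : ℝ) ≤ (m : ℕ) := by positivity
    have h4 : (0 : ℝ) ≤ (k : ℕ) := by positivity
    rw [abs_lt]; constructor <;> linarith)
  rw [abs_lt] at hlt
  have h2 := Int.floor_le (q * (y - x))
  have h3 := Int.lt_floor_add_one (q * (y - x))
  have haR : (a : ℝ) = ⌊q * (y - x)⌋ - 1 := by rw [ha]; push_cast; ring
  have hcR : (k : ℝ) = m + i - c * q := by exact_mod_cast hc
  have hdR : (i : ℝ) * p = a + d * q := by exact_mod_cast hd
  refine ⟨c * p - d, (q * (y - x) - a + (m - k) * (q * α - p)) / q, ?_, ?_, ?_⟩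
  · apply div_nonneg _ hq.le
    linarith
  · gcongr
    linarith
  · push_cast
    field_simp
    linear_combination -p * hcR - hdR

/-! ### Comparing eigenvalues at different phases. -/

/-- The condition D ≤ fract y says that moving back from y by D does not cross the jump, so both
points reduce to the same branch of v. -/
theorem IsSawtoothPotential.add_le {v : ℝ → ℝ} {γm γp : ℝ} (hv : IsSawtoothPotential v γm γp)
    {x y D : ℝ} {N : ℤ} (h : y = x + N + D) (hD : 0 ≤ D) (hDy : D ≤ Int.fract y) :
    v x + γm * D ≤ v y := by
  have hfx : Int.fract x = Int.fract y - D := by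
    rw [Int.fract_eq_iff]
    refine ⟨by linarith, by linarith [Int.fract_lt_one y], ⌊y⌋ - N, ?_⟩
    have := Int.self_sub_fract y
    push_cast
    linarith
  have hper : ∀ z, v z = v (Int.fract z) := fun z => by
    have := hv.periodic.sub_int_mul_eq (x := z) ⌊z⌋
    rw [mul_one] at this
    rw [← this]; rfl
  rw [hper x, hper y]
  have h1 := (hv.lipschitz_monotone (Int.fract x) ⟨Int.fract_nonneg _, Int.fract_lt_one _⟩
    (Int.fract y) ⟨Int.fract_nonneg _, Int.fract_lt_one _⟩ (by linarith)).1
  have h2 : Int.fract y - Int.fract x = D := by linarith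
  rw [h2] at h1
  linarith

theorem IsSawtoothPotential.mem_Icc {v : ℝ → ℝ} {γm γp : ℝ} (hv : IsSawtoothPotential v γm γp)
    (hγ : 0 < γm) (x : ℝ) : v x ∈ Set.Icc (0 : ℝ) 1 := by
  have hmono : ∀ x ∈ Set.Ico (0 : ℝ) 1, ∀ y ∈ Set.Ico (0 : ℝ) 1, x ≤ y → v x ≤ v y := by
    intro x hx y hy hxy
    have := (hv.lipschitz_monotone x hx y hy hxy).1
    nlinarith [mul_nonneg hγ.le (sub_nonneg.2 hxy)]
  have hper : v x = v (Int.fract x) := by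
    have := hv.periodic.sub_int_mul_eq (x := x) ⌊x⌋
    rw [mul_one] at this
    rw [← this]; rfl
  rw [hper]
  have hf : Int.fract x ∈ Set.Ico (0 : ℝ) 1 := ⟨Int.fract_nonneg _, Int.fract_lt_one _⟩
  refine ⟨?_, ?_⟩
  · rw [← hv.map_zero]; exact hmono 0 (by simp) _ hf hf.1
  · refine ge_of_tendsto hv.left_limit_one ?_
    have : Set.Ioo (Int.fract x) 1 ∈ 𝓝[<] (1 : ℝ) := Ioo_mem_nhdsLT hf.2
    filter_upwards [this] with z hz
    exact hmono _ hf z ⟨hf.1.trans hz.1.le, hz.2⟩ hz.1.le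

/-- The eigenvalues of the Jacobi matrices over the orbit segments of length `q` of two phases
interlace up to a bounded index shift, also after changing two rows and columns of each. -/
theorem eigenvalue_le_of_phases {α : ℝ} {p : ℤ} {q : ℕ} (h : IsGoodApprox α p q)
    {v : ℝ → ℝ} {γm γp : ℝ} (hv : IsSawtoothPotential v γm γp) (hγ : 0 < γm) {κ : ℝ} (hκ : 0 ≤ κ)
    (s t x y : ℝ) {A U B V : Matrix (Fin q) (Fin q) ℝ}
    {a b : Fin q → ℝ} (ha : Monotone a) (hb : Monotone b)
    (hU : U * U.transpose = 1) (hA : A = U * Matrix.diagonal a * U.transpose)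
    (hV : V * V.transpose = 1) (hB : B = V * Matrix.diagonal b * V.transpose)
    (T T' : Finset (Fin q)) (hT : T.card ≤ 2) (hT' : T'.card ≤ 2)
    (hAT : ∀ m ∉ T, ∀ m' ∉ T, A m m' = jacobi s (fun m => κ * v (x + m * α) + t) q m m')
    (hBT : ∀ m ∉ T', ∀ m' ∉ T', B m m' = jacobi s (fun m => κ * v (y + m * α) + t) q m m')
    (i j : Fin q) (hij : (i : ℕ) + 11 ≤ j) : a i ≤ b j := by
  classical
  obtain ⟨σ, ⟨l, hl⟩, hσ⟩ := h.exists_shift x y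
  have hlast : q - 1 < q := by have := h.pos; omega
  let e : Fin q := ⟨q - 1, hlast⟩
  -- Exceptional sites: at most 5 where the displacement may cross the jump of v, 2 where the cyclic
  -- relabelling cuts a bond, and 2 + 2 for the altered rows. The sum is 11.
  let X : Finset (Fin q) := (Finset.univ.filter fun m : Fin q => Int.fract (y + m * α) < 3 / q) ∪
    ({e, σ.symm e} ∪ (T' ∪ T.image σ.symm))
  have hX : X.card ≤ 11 := by
    have h1 := Finset.card_union_le
      (Finset.univ.filter fun m : Fin q => Int.fract (y + m * α) < 3 / q)
      ({e, σ.symm e} ∪ (T' ∪ T.image σ.symm))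
    have h2 := Finset.card_union_le {e, σ.symm e} (T' ∪ T.image σ.symm)
    have h3 := Finset.card_union_le T' (T.image σ.symm)
    have h4 := Finset.card_image_le (s := T) (f := σ.symm)
    have h5 := h.card_fract_lt y
    have h6 := Finset.card_le_two (a := e) (b := σ.symm e)
    simp only [X]
    omega
  have hmem : ∀ m ∉ X, 3 / q ≤ Int.fract (y + m * α) ∧ (m : ℕ) + 1 ≠ q ∧ (σ m : ℕ) + 1 ≠ q ∧
      m ∉ T' ∧ σ m ∉ T := by
    intro m hm
    simp only [X, Finset.mem_union, Finset.mem_filter, Finset.mem_univ, true_and, not_or, not_lt,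
      Finset.mem_insert, Finset.mem_singleton, Finset.mem_image, not_exists, not_and] at hm
    obtain ⟨h1, ⟨h2, h3⟩, h4, h5⟩ := hm
    refine ⟨h1, fun h => h2 (Fin.ext ?_), fun h => h3 ?_, h4, fun h => h5 _ h (by simp)⟩
    · simp only [e]; omega
    · rw [Equiv.eq_symm_apply]
      exact Fin.ext (by simp only [e]; omega)
  have key := eigenvalue_le_of_entries ha hb hU hA hV hB σ X hX 0 ?_ ?_ i j hij
  · linarith
  · intro m hm m' hm' hne
    obtain ⟨-, m1, m2, m3, m4⟩ := hmem m hm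
    obtain ⟨-, m1', m2', m3', m4'⟩ := hmem m' hm'
    rw [hAT _ m4 _ m4', hBT _ m3 _ m3']
    have hne' : σ m ≠ σ m' := fun h => hne (σ.injective h)
    have hiff : ((σ m : ℕ) + 1 = σ m' ∨ (σ m' : ℕ) + 1 = σ m) ↔
        ((m : ℕ) + 1 = m' ∨ (m' : ℕ) + 1 = m) := by
      have a1 := hl m
      have a2 := hl m'
      have := m.2; have := m'.2; have := (σ m).2; have := (σ m').2
      omega
    simp only [jacobi, Matrix.of_apply, if_neg hne, if_neg hne', hiff]
  · intro m hm
    obtain ⟨m0, -, -, m3, m4⟩ := hmem m hm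
    rw [hAT _ m4 _ m4, hBT _ m3 _ m3]
    obtain ⟨N, D, hD0, hD1, hD⟩ := hσ m
    have h1 := hv.add_le hD hD0 (hD1.trans m0)
    have h2 : v (x + (σ m : ℕ) * α) ≤ v (y + m * α) := by nlinarith [mul_nonneg hγ.le hD0]
    simp only [jacobi, Matrix.of_apply, if_true]
    nlinarith [mul_le_mul_of_nonneg_left h2 hκ]

/-- The eigenvalue whose index is the rank of `x + m α` among the orbit points mod `1` is strictly
increasing as `x + m α` runs through `[0, 1)`. -/
theorem eigenvalue_branch_le {α : ℝ} {q : ℕ}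
    {v : ℝ → ℝ} {γm γp : ℝ} (hv : IsSawtoothPotential v γm γp) {κ : ℝ} (hκ : 0 ≤ κ)
    (s t x y : ℝ) {U V : Matrix (Fin q) (Fin q) ℝ}
    {a b : Fin q → ℝ} (ha : Monotone a) (hb : Monotone b)
    (hU : U * U.transpose = 1)
    (hA : jacobi s (fun m => κ * v (x + m * α) + t) q = U * Matrix.diagonal a * U.transpose)
    (hV : V * V.transpose = 1)
    (hB : jacobi s (fun m => κ * v (y + m * α) + t) q = V * Matrix.diagonal b * V.transpose)
    (k i j : Fin q) (hk : Int.fract (x + k * α) ≤ Int.fract (y + k * α))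
    (hi : (Finset.univ.filter fun m : Fin q =>
      Int.fract (x + m * α) < Int.fract (x + k * α)).card = i)
    (hj : (Finset.univ.filter fun m : Fin q =>
      Int.fract (y + m * α) < Int.fract (y + k * α)).card = j) :
    a i + κ * γm * (Int.fract (y + k * α) - Int.fract (x + k * α)) ≤ b j := by
  classical
  set d := Int.fract (y + k * α) - Int.fract (x + k * α) with hd
  -- These are the orbit points that cross an integer when the phase advances by `d`; only there can
  -- the potential drop.
  let X : Finset (Fin q) := Finset.univ.filter fun m : Fin q =>
    Int.fract (y + m * α) ≠ Int.fract (x + m * α) + d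
  have hxy : ∀ m : Fin q, ∃ N : ℤ, y + m * α = x + m * α + N + d := fun m =>
    ⟨⌊y + k * α⌋ - ⌊x + k * α⌋, by
      have h1 := Int.self_sub_fract (y + k * α)
      have h2 := Int.self_sub_fract (x + k * α)
      push_cast
      linarith⟩
  have hd1 : d < 1 := by linarith [Int.fract_lt_one (y + k * α), Int.fract_nonneg (x + k * α)]
  have hwrap : ∀ m ∈ X, Int.fract (y + m * α) = Int.fract (x + m * α) + d - 1 := by
    intro m hm
    obtain ⟨N, hN⟩ := hxy m
    have h1 := Int.fract_lt_one (y + m * α)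
    have h2 := Int.fract_nonneg (x + m * α)
    have h3 := Int.fract_lt_one (x + m * α)
    have h4 := Int.fract_nonneg (y + m * α)
    have e1 := Int.self_sub_fract (y + m * α)
    have e2 := Int.self_sub_fract (x + m * α)
    have e : Int.fract (y + m * α) = Int.fract (x + m * α) + d +
        ((⌊x + m * α⌋ - ⌊y + m * α⌋ + N : ℤ) : ℝ) := by push_cast; linarith
    set z : ℤ := ⌊x + m * α⌋ - ⌊y + m * α⌋ + N
    have hz0 : z ≠ 0 := fun h0 => (Finset.mem_filter.1 hm).2 (by rw [e, h0]; simp)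
    have hz1 : (z : ℝ) < 1 := by linarith
    have hz2 : (-2 : ℝ) < z := by linarith
    have hz1' : z < 1 := by exact_mod_cast hz1
    have hz2' : -2 < z := by exact_mod_cast hz2
    have hz : z = -1 := by omega
    rw [e, hz]; push_cast; ring
  -- A wrapped point lies above point `k` before the move and below it afterwards, while points
  -- already below stay below. The rank thus gains the index shift that Weyl's inequality costs.
  have hcard : (i : ℕ) + X.card ≤ j := by
    rw [← hi, ← hj, ← Finset.card_union_of_disjoint]
    · refine Finset.card_le_card fun m hm => ?_
      simp only [Finset.mem_filter, Finset.mem_univ, true_and]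
      by_cases hmX : m ∈ X
      · rw [hwrap m hmX]
        linarith [Int.fract_lt_one (x + m * α), Int.fract_nonneg (x + k * α)]
      · have h1 := (Finset.mem_filter.1 ((Finset.mem_union.1 hm).resolve_right hmX)).2
        have h2 : Int.fract (y + m * α) = Int.fract (x + m * α) + d := by simpa [X] using hmX
        rw [h2]; linarith
    · rw [Finset.disjoint_left]
      intro m hm hmX
      have h1 := (Finset.mem_filter.1 hm).2
      linarith [hwrap m hmX, Int.fract_nonneg (y + m * α), Int.fract_lt_one (y + k * α)]
  refine eigenvalue_le_of_entries ha hb hU hA hV hB (Equiv.refl _) X le_rfl _ ?_ ?_ i j hcard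
  · intro m _ m' _ hne
    simp [jacobi, hne]
  · intro m hm
    have h2 : Int.fract (y + m * α) = Int.fract (x + m * α) + d := by simpa [X] using hm
    obtain ⟨N, hN⟩ := hxy m
    have h1 := hv.add_le hN (by linarith) (by linarith [Int.fract_nonneg (x + m * α)])
    simp only [jacobi, Matrix.of_apply, if_true, Equiv.refl_apply]
    nlinarith [mul_le_mul_of_nonneg_left h1 hκ]

/-! ### Covering by arcs the phases with a small eigenvalue. -/

/-- The rank is strictly increasing in the value, hence injective on a finite set and so surjective:
every eigenvalue index belongs to some orbit point. -/
theorem exists_card_filter_lt_eq {q : ℕ} {f : Fin q → ℝ} (hf : Function.Injective f) (j : Fin q) :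
    ∃ k, (Finset.univ.filter fun m => f m < f k).card = j := by
  have hlt : ∀ k, (Finset.univ.filter fun m => f m < f k).card < q := fun k => by
    have : (Finset.univ.filter fun m => f m < f k) ⊂ Finset.univ :=
      Finset.filter_ssubset.2 ⟨k, Finset.mem_univ _, lt_irrefl _⟩
    simpa using Finset.card_lt_card this
  let g : Fin q → Fin q := fun k => ⟨_, hlt k⟩
  have hmono : ∀ k k', f k < f k' → g k < g k' := by
    intro k k' h
    have : (Finset.univ.filter fun m => f m < f k) ⊂ Finset.univ.filter fun m => f m < f k' := by
      refine (Finset.ssubset_iff_of_subset ?_).2 ⟨k, ?_, ?_⟩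
      · intro m hm
        simp only [Finset.mem_filter, Finset.mem_univ, true_and] at hm ⊢
        exact hm.trans h
      · simpa using h
      · simp
    exact Finset.card_lt_card this
  have hinj : Function.Injective g := by
    intro k k' h
    rcases lt_trichotomy (f k) (f k') with h' | h' | h'
    · exact absurd h (hmono _ _ h').ne
    · exact hf h'
    · exact absurd h (hmono _ _ h').ne'
  obtain ⟨k, hk⟩ := (Finite.injective_iff_surjective.1 hinj) j
  exact ⟨k, congrArg Fin.val hk⟩

theorem CoveredByArcs.mono {S S' : Set ℝ} {N : ℕ} {l l' : ℝ} (h : CoveredByArcs S' N l)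
    (hS : S ⊆ S') (hl : l ≤ l') : CoveredByArcs S N l' := by
  obtain ⟨c, hc⟩ := h
  refine ⟨c, fun x hx => ?_⟩
  obtain ⟨j, n, h1, h2⟩ := hc x (hS hx)
  exact ⟨j, n, h1, h2.trans (by linarith)⟩

theorem CoveredByArcs.volume_le {S : Set ℝ} {N : ℕ} {l : ℝ} (h : CoveredByArcs S N l)
    (hS : S ⊆ Set.Ico 0 1) (hl0 : 0 ≤ l) (hl1 : l ≤ 1) :
    volume S ≤ ENNReal.ofReal (2 * N * l) := by
  obtain ⟨c, hc⟩ := h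
  -- An arc of length at most 1 starting in [0, 1) can meet [0, 1) only directly or after
  -- translation by −1, whence the factor 2 in the measure bound.
  have hsub : S ⊆ ⋃ j : Fin N, (Set.Icc (c j - ⌊c j⌋) (c j - ⌊c j⌋ + l) ∪
      Set.Icc (c j - ⌊c j⌋ - 1) (c j - ⌊c j⌋ - 1 + l)) := by
    intro x hx
    obtain ⟨j, n, h1, h2⟩ := hc x hx
    obtain ⟨h3, h4⟩ := hS hx
    refine Set.mem_iUnion.2 ⟨j, ?_⟩
    have f1 := Int.floor_le (c j)
    have f2 := Int.lt_floor_add_one (c j)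
    have n1 : ⌊c j⌋ - 1 < n := by
      have : ((⌊c j⌋ - 1 : ℤ) : ℝ) < n := by push_cast; linarith
      exact_mod_cast this
    have n2 : n < ⌊c j⌋ + 2 := by
      have : (n : ℝ) < ((⌊c j⌋ + 2 : ℤ) : ℝ) := by push_cast; linarith
      exact_mod_cast this
    rcases (show n = ⌊c j⌋ ∨ n = ⌊c j⌋ + 1 by omega) with h | h
    · left
      rw [h] at h1 h2
      constructor <;> linarith
    · right
      rw [h] at h1 h2
      push_cast at h1 h2
      constructor <;> linarith
  have hj : ∀ j : Fin N, volume (Set.Icc (c j - ⌊c j⌋) (c j - ⌊c j⌋ + l) ∪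
      Set.Icc (c j - ⌊c j⌋ - 1) (c j - ⌊c j⌋ - 1 + l)) ≤ ENNReal.ofReal (2 * l) := by
    intro j
    refine (measure_union_le _ _).trans ?_
    rw [Real.volume_Icc, Real.volume_Icc, ← ENNReal.ofReal_add (by linarith) (by linarith)]
    exact ENNReal.ofReal_le_ofReal (by linarith)
  calc volume S ≤ _ := measure_mono hsub
    _ ≤ ∑ j : Fin N, _ := measure_iUnion_fintype_le _ _
    _ ≤ ∑ _j : Fin N, ENNReal.ofReal (2 * l) := Finset.sum_le_sum fun j _ => hj j
    _ = ENNReal.ofReal (2 * N * l) := by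
      rw [Finset.sum_const, Finset.card_univ, Fintype.card_fin, nsmul_eq_mul,
        ← ENNReal.ofReal_natCast, ← ENNReal.ofReal_mul (by positivity)]
      congr 1; ring

/-- The phases at which one of the Jacobi matrices of size `q` has an eigenvalue `η`-close to `0`
are covered by `q` arcs of length proportional to `η`. -/
theorem coveredByArcs_small_eigenvalue {α : ℝ} (hα : Irrational α) {q : ℕ}
    {v : ℝ → ℝ} {γm γp : ℝ} (hv : IsSawtoothPotential v γm γp) (hγ : 0 < γm) {κ : ℝ} (hκ : 0 < κ)
    (s t : ℝ) {a : ℝ → Fin q → ℝ} {U : ℝ → Matrix (Fin q) (Fin q) ℝ} (ha : ∀ x, Monotone (a x))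
    (hU : ∀ x, U x * (U x).transpose = 1)
    (hA : ∀ x, jacobi s (fun m => κ * v (x + m * α) + t) q =
      U x * Matrix.diagonal (a x) * (U x).transpose) (η : ℝ) :
    CoveredByArcs {x | ∃ j, |a x j| < η} q (2 * η / (κ * γm)) := by
  set l := 2 * η / (κ * γm) with hl
  have hκγ : 0 < κ * γm := mul_pos hκ hγ
  -- `B k` collects the phases whose small eigenvalue lies on branch `k`. By monotonicity of the
  -- branch, fract (x + kα) varies there by at most `l`, so one arc starting at the infimum
  -- suffices.
  let B : Fin q → Set ℝ := fun k => {x | ∃ j, |a x j| < η ∧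
    (Finset.univ.filter fun m : Fin q => Int.fract (x + m * α) < Int.fract (x + k * α)).card = j}
  have hB : ∀ k, ∀ x ∈ B k, ∀ y ∈ B k, Int.fract (y + k * α) ≤ Int.fract (x + k * α) + l := by
    rintro k x ⟨i, hi, hix⟩ y ⟨j, hj, hjy⟩
    have hη : 0 < η := (abs_nonneg _).trans_lt hi
    rcases le_total (Int.fract (x + k * α)) (Int.fract (y + k * α)) with h | h
    · have h1 := eigenvalue_branch_le hv hκ.le s t x y (ha x) (ha y) (hU x) (hA x) (hU y) (hA y)
        k i j h hix hjy
      rw [abs_lt] at hi hj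
      have h2 : Int.fract (y + k * α) - Int.fract (x + k * α) ≤ l := by
        rw [hl, le_div_iff₀ hκγ]; linarith
      linarith
    · have : 0 ≤ l := by positivity
      linarith
  refine ⟨fun k => sInf ((fun x => Int.fract (x + k * α)) '' B k) - k * α, ?_⟩
  rintro x ⟨j, hj⟩
  have hinj : Function.Injective fun m : Fin q => Int.fract (x + m * α) := by
    intro m m' h
    obtain ⟨z, hz⟩ := Int.fract_eq_fract.1 h
    by_contra hne
    have hne' : ((m : ℕ) : ℤ) - (m' : ℕ) ≠ 0 := fun h0 => hne (Fin.ext (by omega))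
    have h1 := (hα.intCast_mul hne').ne_int z
    apply h1
    push_cast
    linarith
  obtain ⟨k, hk⟩ := exists_card_filter_lt_eq hinj j
  have hxB : x ∈ B k := ⟨j, hj, hk⟩
  have hbdd : BddBelow ((fun x => Int.fract (x + k * α)) '' B k) :=
    ⟨0, by rintro _ ⟨y, _, rfl⟩; exact Int.fract_nonneg _⟩
  have h1 := csInf_le hbdd ⟨x, hxB, rfl⟩
  have h2 : Int.fract (x + k * α) - l ≤ sInf ((fun x => Int.fract (x + k * α)) '' B k) := by
    refine le_csInf ⟨_, x, hxB, rfl⟩ ?_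
    rintro _ ⟨y, hy, rfl⟩
    have := hB k y hy x hxB
    simp only
    linarith
  have h3 := Int.self_sub_fract (x + k * α)
  simp only at h1
  refine ⟨k, -⌊x + k * α⌋, ?_⟩
  push_cast
  constructor <;> linarith

/-! ### Transfer matrix norms and the Lyapunov exponent. -/

theorem sum_abs_jacobi_le {s : ℝ} (hs : |s| = 1) (c : ℕ → ℝ) {n : ℕ} {K : ℝ}
    (hc : ∀ m, |c m| ≤ K) (i : Fin n) : ∑ j, |jacobi s c n i j| ≤ K + 2 := by
  classical
  have h : ∀ j, |jacobi s c n i j| ≤ (if i = j then K else 0) +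
      ((if (i : ℕ) + 1 = j then 1 else 0) + (if (j : ℕ) + 1 = i then 1 else 0)) := by
    intro j
    simp only [jacobi, Matrix.of_apply]
    by_cases h1 : i = j
    · subst h1
      simpa using hc _
    · by_cases h2 : (i : ℕ) + 1 = j
      · have h3 : ¬ (j : ℕ) + 1 = i := by omega
        simp [h1, h2, h3, hs]
      · by_cases h3 : (j : ℕ) + 1 = i
        · simp [h1, h2, h3, hs]
        · simp [h1, h2, h3]
  refine (Finset.sum_le_sum fun j _ => h j).trans ?_
  rw [Finset.sum_add_distrib, Finset.sum_add_distrib, Finset.sum_ite_eq, if_pos (Finset.mem_univ _),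
    Finset.sum_boole, Finset.sum_boole]
  have c1 : (Finset.univ.filter fun j : Fin n => (i : ℕ) + 1 = j).card ≤ 1 :=
    Finset.card_le_one.2 fun a ha b hb => Fin.ext (by
      have := (Finset.mem_filter.1 ha).2
      have := (Finset.mem_filter.1 hb).2
      omega)
  have c2 : (Finset.univ.filter fun j : Fin n => (j : ℕ) + 1 = i).card ≤ 1 :=
    Finset.card_le_one.2 fun a ha b hb => Fin.ext (by
      have := (Finset.mem_filter.1 ha).2
      have := (Finset.mem_filter.1 hb).2
      omega)
  have c1' : ((Finset.univ.filter fun j : Fin n => (i : ℕ) + 1 = j).card : ℝ) ≤ 1 := by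
    exact_mod_cast c1
  have c2' : ((Finset.univ.filter fun j : Fin n => (j : ℕ) + 1 = i).card : ℝ) ≤ 1 := by
    exact_mod_cast c2
  linarith

/-- The transfer matrix at one phase is controlled by the determinant at any other phase, provided
the latter is not close to an eigenvalue. -/
theorem norm_transferMatrix_le {α : ℝ} {p : ℤ} {q : ℕ} (h : IsGoodApprox α p q) (hq : 2 ≤ q)
    {v : ℝ → ℝ} {γm γp : ℝ} (hv : IsSawtoothPotential v γm γp) (hγ : 0 < γm)
    {lam s : ℝ} (hs : s ^ 2 = 1) (hslam : 0 ≤ s * lam) (E x y : ℝ)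
    {a : Fin q → ℝ} {U : Matrix (Fin q) (Fin q) ℝ} (ha : Monotone a)
    (hU : U * U.transpose = 1)
    (hA : jacobi s (fun m => s * lam * v (x + m * α) + -(s * E)) q =
      U * Matrix.diagonal a * U.transpose)
    {η : ℝ} (hη : 0 < η) (hη1 : η ≤ 1) (haη : ∀ j, η ≤ |a j|) :
    ‖Matrix.toEuclideanCLM (𝕜 := ℝ) (transferMatrix α lam v y E q)‖ * η ^ 44 ≤
      8 * (|lam| + |E| + 4) ^ 44 * |dirichletDet α lam v q x E| := by
  classical
  obtain ⟨n, rfl⟩ : ∃ n, q = n + 2 := ⟨q - 2, by omega⟩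
  have hs1 : |s| = 1 := by
    rw [← abs_of_pos one_pos]
    exact sq_eq_sq_iff_abs_eq_abs _ _ |>.1 (by rw [hs]; norm_num)
  obtain ⟨τ, ⟨hτ0, hτ1⟩, τ', ⟨hτ0', hτ1'⟩, hnorm⟩ :=
    exists_boundary_norm_le (fun m => E - lam * v (y + m * α)) n
  set c : ℕ → ℝ := fun m => (fun m : ℕ => E - lam * v (y + m * α)) m -
        (if m = n + 1 then τ else 0) - (if m = 0 then τ' else 0) with hc
  rw [transferMatrix_eq_cocycle]
  rw [← abs_det_jacobi_neg_mul s hs] at hnorm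
  obtain ⟨b, V, hb, hV, hB⟩ := exists_monotone_diagonalization
    (jacobi s (fun m => -(s * c m)) (n + 2)) (jacobi_isSymm _ _ _)
  have hcb : ∀ m, |-(s * c m)| ≤ |lam| + |E| + 2 := by
    intro m
    rw [abs_neg, abs_mul, hs1, one_mul]
    have hv' := hv.mem_Icc hγ (y + m * α)
    have h1 : |lam * v (y + m * α)| ≤ |lam| := by
      rw [abs_mul, abs_of_nonneg hv'.1]
      exact mul_le_of_le_one_right (abs_nonneg _) hv'.2
    have h2 : |(if m = n + 1 then τ else 0)| ≤ 1 := by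
      split_ifs <;> simp [abs_of_nonneg, *]
    have h3 : |(if m = 0 then τ' else 0)| ≤ 1 := by
      split_ifs <;> simp [abs_of_nonneg, *]
    have e1 := abs_le.1 h1
    have e2 := abs_le.1 h2
    have e3 := abs_le.1 h3
    have e4 := neg_abs_le E
    have e5 := le_abs_self E
    simp only [hc]
    rw [abs_le]
    constructor <;> linarith
  have hbR : ∀ j, |b j| ≤ |lam| + |E| + 4 := fun j => by
    have := abs_eigenvalue_le_of_row_sum hV hB (fun i => sum_abs_jacobi_le hs1 _ hcb i) j
    linarith
  -- The boundary coefficients change only the first and last rows, which the index shift 11 already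
  -- allows for. The exponent is 44 = 4 · 11.
  let T : Finset (Fin (n + 2)) := {0, Fin.last (n + 1)}
  have hT : T.card ≤ 2 := Finset.card_le_two
  have hBT : ∀ m ∉ T, ∀ m' ∉ T, jacobi s (fun m => -(s * c m)) (n + 2) m m' =
      jacobi s (fun m => s * lam * v (y + m * α) + -(s * E)) (n + 2) m m' := by
    intro m hm m' _
    simp only [T, Finset.mem_insert, Finset.mem_singleton, not_or, Fin.ext_iff, Fin.val_last,
      Fin.val_zero] at hm
    simp only [jacobi, Matrix.of_apply]
    have : -(s * c m) = s * lam * v (y + m * α) + -(s * E) := by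
      simp only [hc, if_neg hm.1, if_neg hm.2]; ring
    rw [this]
  have hab : ∀ i j : Fin (n + 2), (i : ℕ) + 11 ≤ j → a i ≤ b j ∧ b i ≤ a j := fun i j hij =>
    ⟨eigenvalue_le_of_phases h hv hγ hslam s (-(s * E)) x y ha hb hU hA hV hB ∅ T (by simp) hT
      (fun _ _ _ _ => rfl) hBT i j hij,
    eigenvalue_le_of_phases h hv hγ hslam s (-(s * E)) y x hb ha hV hB hU hA T ∅ hT (by simp)
      hBT (fun _ _ _ _ => rfl) i j hij⟩
  have hprod := prod_abs_le_of_interlace ha hab (R := |lam| + |E| + 4)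
    (by linarith [abs_nonneg lam, abs_nonneg E]) hbR hη hη1 haη
  rw [← Finset.abs_prod, ← Finset.abs_prod, ← det_eq_prod_of_diagonalization hV hB,
    ← det_eq_prod_of_diagonalization hU hA] at hprod
  have hdet : |(jacobi s (fun m => s * lam * v (x + m * α) + -(s * E)) (n + 2)).det| =
      |dirichletDet α lam v (n + 2) x E| := by
    rw [abs_dirichletDet, ← abs_det_jacobi_neg_mul s hs]
    congr 4
    funext m; ring
  rw [hdet] at hprod
  rw [show 4 * 11 = 44 from rfl] at hprod
  have hp := pow_pos hη 44
  generalize η ^ 44 = P at hprod hp ⊢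
  generalize (|lam| + |E| + 4) ^ 44 = Q at hprod ⊢
  calc _ ≤ _ := mul_le_mul_of_nonneg_right hnorm hp.le
    _ ≤ _ := by linarith

theorem log_norm_transferMatrix_nonneg (α lam : ℝ) (v : ℝ → ℝ) (x E : ℝ) (n : ℕ) :
    0 ≤ Real.log ‖Matrix.toEuclideanCLM (𝕜 := ℝ) (transferMatrix α lam v x E n)‖ := by
  rw [transferMatrix_eq_cocycle]
  exact Real.log_nonneg (one_le_norm_toEuclideanCLM (det_cocycle _ _))

theorem lyapunov_le (α lam : ℝ) (v : ℝ → ℝ) (E : ℝ) {n : ℕ} (hn : 0 < n) :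
    lyapunov α lam v E ≤ (1 / (n : ℝ)) * ∫ x in Set.Ico (0 : ℝ) 1,
      Real.log ‖Matrix.toEuclideanCLM (𝕜 := ℝ) (transferMatrix α lam v x E n)‖ := by
  refine ciInf_le (f := fun n : ℕ+ => (1 / (n : ℝ)) * ∫ x in Set.Ico (0 : ℝ) 1,
    Real.log ‖Matrix.toEuclideanCLM (𝕜 := ℝ) (transferMatrix α lam v x E n)‖) ?_ ⟨n, hn⟩
  refine ⟨0, ?_⟩
  rintro _ ⟨m, rfl⟩
  exact mul_nonneg (by positivity)
    (integral_nonneg fun x => log_norm_transferMatrix_nonneg α lam v x E m)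

/-- A mean is at most a uniform bound. As the logarithm is nonnegative, only the constant needs to
be integrable. -/
theorem lyapunov_le_of_forall_le {α lam : ℝ} {v : ℝ → ℝ} {E c : ℝ} {n : ℕ} (hn : 0 < n)
    (h : ∀ x, Real.log ‖Matrix.toEuclideanCLM (𝕜 := ℝ) (transferMatrix α lam v x E n)‖ ≤ c) :
    n * lyapunov α lam v E ≤ c := by
  have h1 := lyapunov_le α lam v E hn
  have h2 : ∫ x in Set.Ico (0 : ℝ) 1,
      Real.log ‖Matrix.toEuclideanCLM (𝕜 := ℝ) (transferMatrix α lam v x E n)‖ ≤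
      ∫ _x in Set.Ico (0 : ℝ) 1, c :=
    integral_mono_of_nonneg (ae_of_all _ fun x => log_norm_transferMatrix_nonneg α lam v x E n)
      (by simp) (ae_of_all _ h)
  have h3 : ∫ _x in Set.Ico (0 : ℝ) 1, c = c := by simp
  rw [h3] at h2
  have hn' : (0 : ℝ) < n := by exact_mod_cast hn
  calc n * lyapunov α lam v E ≤ n * (1 / (n : ℝ) * c) := by gcongr; exact h1.trans (by gcongr)
    _ = c := by field_simp

theorem exists_lt_norm_transferMatrix (α lam : ℝ) (v : ℝ → ℝ) (E : ℝ) {n : ℕ} (hn : 0 < n)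
    {c : ℝ} (hc : c < n * lyapunov α lam v E) :
    ∃ y, Real.exp c < ‖Matrix.toEuclideanCLM (𝕜 := ℝ) (transferMatrix α lam v y E n)‖ := by
  by_contra hcon
  push Not at hcon
  refine absurd (lyapunov_le_of_forall_le hn fun x => ?_) (not_le.2 hc)
  have hpos : 0 < ‖Matrix.toEuclideanCLM (𝕜 := ℝ) (transferMatrix α lam v x E n)‖ := by
    rw [transferMatrix_eq_cocycle]
    exact one_pos.trans_le (one_le_norm_toEuclideanCLM (det_cocycle _ _))
  rw [← Real.log_exp c]
  exact Real.log_le_log hpos (hcon x)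

theorem eventually_mul_lt_exp (K : ℝ) {c : ℝ} (hc : 0 < c) :
    ∀ᶠ n : ℕ in atTop, K * (n + 1) < Real.exp (c * n) := by
  have h1 : Tendsto (fun n : ℕ => (n : ℝ)) atTop atTop := tendsto_natCast_atTop_atTop
  -- The threshold makes 2|K|n < (cn)²/2, the quadratic term of the exponential.
  filter_upwards [h1.eventually_gt_atTop (4 * |K| / c ^ 2), h1.eventually_ge_atTop 1] with n h2 h3
  have h4 := Real.quadratic_le_exp_of_nonneg (x := c * n) (by positivity)
  rw [div_lt_iff₀ (by positivity)] at h2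
  have h5 : K * (n + 1) ≤ |K| * (2 * n) :=
    (mul_le_mul_of_nonneg_right (le_abs_self K) (by positivity)).trans
      (mul_le_mul_of_nonneg_left (by linarith) (abs_nonneg K))
  have h6 : 0 < c * n := by positivity
  nlinarith

/-! ### The free case `lam = 0`. -/

theorem cocycle_const_add_two (E : ℝ) (n : ℕ) : cocycle (fun _ => E) (n + 2) =
    !![cocycle (fun _ => E) (n + 2) 0 0, -cocycle (fun _ => E) (n + 1) 0 0;
      cocycle (fun _ => E) (n + 1) 0 0, -cocycle (fun _ => E) n 0 0] := by
  ext i j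
  fin_cases i <;> fin_cases j
  · rfl
  · simp only [Fin.zero_eta, Fin.mk_one]
    rw [cocycle_succ' _ (n + 1)]
    simp [Matrix.mul_apply, Fin.sum_univ_two]
  · simp only [Fin.zero_eta, Fin.mk_one]
    rw [cocycle]
    simp [Matrix.mul_apply, Fin.sum_univ_two]
  · simp only [Fin.mk_one]
    rw [cocycle, cocycle_succ' _ n]
    simp [Matrix.mul_apply, Fin.sum_univ_two]

theorem cocycle_const_rec (E : ℝ) (n : ℕ) : cocycle (fun _ => E) (n + 2) 0 0 =
    E * cocycle (fun _ => E) (n + 1) 0 0 - cocycle (fun _ => E) n 0 0 :=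
  cocycle_zero_zero_rec _ n

/-- Consecutive terms A, B conserve B² + A² − E A B = (B − E A/2)² + (1 − E²/4) A² = 1. For |E| ≤ 2
this gives |B − E A/2| ≤ 1, so each step adds at most 1. -/
theorem abs_cocycle_const_le {E : ℝ} (hE : |E| ≤ 2) (n : ℕ) :
    |cocycle (fun _ => E) n 0 0| ≤ n + 1 := by
  have hinv : ∀ n, cocycle (fun _ => E) (n + 1) 0 0 ^ 2 + cocycle (fun _ => E) n 0 0 ^ 2 -
      E * cocycle (fun _ => E) (n + 1) 0 0 * cocycle (fun _ => E) n 0 0 = 1 := by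
    intro n
    induction n with
    | zero => simp [cocycle]; ring
    | succ n ih => rw [cocycle_const_rec]; linear_combination ih
  induction n with
  | zero => simp [cocycle]
  | succ n ih =>
    set A := cocycle (fun _ => E) n 0 0
    set B := cocycle (fun _ => E) (n + 1) 0 0
    have h := hinv n
    have hE2 : E ^ 2 ≤ 4 := by
      have := sq_le_sq' (abs_le.1 hE).1 (abs_le.1 hE).2
      linarith
    have h1 : (B - E / 2 * A) ^ 2 ≤ 1 := by nlinarith [sq_nonneg A]
    have h2 : |B - E / 2 * A| ≤ 1 := (sq_le_one_iff_abs_le_one _).1 h1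
    have h3 : |E / 2 * A| ≤ |A| := by
      rw [abs_mul]
      refine mul_le_of_le_one_left (abs_nonneg _) ?_
      rw [abs_div, abs_two]; linarith
    have h4 : B = (B - E / 2 * A) + E / 2 * A := by ring
    rw [h4]
    refine (abs_add_le _ _).trans ?_
    push_cast
    linarith

/-- Let t be the root of t + 1/t = E with |t| > 1. The sequence is t^n (1 + t^{−2} + … + t^{−2n}),
and the bracket lies in [1, n + 1]; the constant supplied is |t|. -/
theorem exists_cocycle_const_bounds {E : ℝ} (hE : 2 < |E|) :
    ∃ t : ℝ, 1 ≤ t ∧ ∀ n, t ^ n ≤ |cocycle (fun _ => E) n 0 0| ∧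
      |cocycle (fun _ => E) n 0 0| ≤ (n + 1) * t ^ n := by
  obtain ⟨t, ht1, ht⟩ : ∃ t : ℝ, 1 < |t| ∧ E * t = t ^ 2 + 1 := by
    have hd : 0 < E ^ 2 - 4 := by
      rw [← sq_abs]; nlinarith
    have hsq := Real.sq_sqrt hd.le
    have hs0 := Real.sqrt_pos.2 hd
    rcases lt_abs.1 hE with h | h
    · refine ⟨(E + √(E ^ 2 - 4)) / 2, ?_, by linear_combination -hsq / 4⟩
      rw [lt_abs]; left; linarith
    · refine ⟨(E - √(E ^ 2 - 4)) / 2, ?_, by linear_combination -hsq / 4⟩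
      rw [lt_abs]; right; linarith
  have ht0 : t ≠ 0 := by
    rintro rfl; simp at ht1; linarith
  have hr : (t⁻¹) ^ 2 ≤ 1 := by
    rw [inv_pow]
    refine inv_le_one_of_one_le₀ ?_
    rw [← sq_abs]; nlinarith
  have hstep : ∀ n, cocycle (fun _ => E) (n + 1) 0 0 =
      t * cocycle (fun _ => E) n 0 0 + (t⁻¹) ^ (n + 1) := by
    intro n
    have hEt : E = t + t⁻¹ := by field_simp; linarith
    induction n with
    | zero => simp [cocycle, hEt]
    | succ n ih =>
      rw [cocycle_const_rec, ih, hEt]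
      have : t⁻¹ * t = 1 := inv_mul_cancel₀ ht0
      linear_combination (cocycle (fun _ => t + t⁻¹) n 0 0) * this
  have hfac : ∀ n : ℕ, ∃ b : ℝ, 1 ≤ b ∧ b ≤ n + 1 ∧ cocycle (fun _ => E) n 0 0 = t ^ n * b := by
    intro n
    induction n with
    | zero => exact ⟨1, le_rfl, by simp, by simp [cocycle]⟩
    | succ n ih =>
      obtain ⟨b, h1, h2, h3⟩ := ih
      have hp0 : 0 ≤ ((t⁻¹) ^ 2) ^ (n + 1) := by positivity
      have hp1 : ((t⁻¹) ^ 2) ^ (n + 1) ≤ 1 := pow_le_one₀ (by positivity) hr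
      refine ⟨b + ((t⁻¹) ^ 2) ^ (n + 1), by linarith, by push_cast; linarith, ?_⟩
      rw [hstep, h3]
      have : t ^ (n + 1) * ((t⁻¹) ^ 2) ^ (n + 1) = t⁻¹ ^ (n + 1) := by
        rw [← mul_pow]; congr 1; field_simp
      rw [mul_add, this]; ring
  refine ⟨|t|, ht1.le, fun n => ?_⟩
  obtain ⟨b, h1, h2, h3⟩ := hfac n
  have hp : 0 < |t| ^ n := by positivity
  rw [h3, abs_mul, abs_pow, abs_of_nonneg (by linarith : (0 : ℝ) ≤ b)]
  constructor <;> nlinarith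

/-- The polynomial factor is negligible on the exponential scale, so an exponent above log t would
be contradicted at one large n. -/
theorem lyapunov_zero_le {α : ℝ} {v : ℝ → ℝ} {E t : ℝ} (ht : 1 ≤ t)
    (h : ∀ n : ℕ, |cocycle (fun _ => E) n 0 0| ≤ (n + 1) * t ^ n) :
    lyapunov α 0 v E ≤ Real.log t := by
  by_contra hcon
  push Not at hcon
  have hc : 0 < lyapunov α 0 v E - Real.log t := by linarith
  obtain ⟨n, hn1, hn2⟩ := ((eventually_mul_lt_exp 2 hc).and (eventually_ge_atTop 2)).exists
  obtain ⟨m, rfl⟩ : ∃ m, n = m + 2 := ⟨n - 2, by omega⟩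
  have ht0 : 0 < t := by linarith
  have hnorm : ∀ x, ‖Matrix.toEuclideanCLM (𝕜 := ℝ) (transferMatrix α 0 v x E (m + 2))‖ ≤
      2 * ((((m + 2 : ℕ) : ℝ) + 1) * t ^ (m + 2)) := by
    intro x
    rw [transferMatrix_eq_cocycle]
    simp only [zero_mul, sub_zero]
    refine norm_toEuclideanCLM_le fun i j => ?_
    have p1 : t ^ (m + 1) ≤ t ^ (m + 2) := pow_le_pow_right₀ ht (by omega)
    have p0 : t ^ m ≤ t ^ (m + 2) := pow_le_pow_right₀ ht (by omega)
    have b2 := h (m + 2)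
    have b1 : |cocycle (fun _ => E) (m + 1) 0 0| ≤ (((m + 2 : ℕ) : ℝ) + 1) * t ^ (m + 2) := by
      refine (h (m + 1)).trans (mul_le_mul ?_ p1 (by positivity) (by positivity))
      push_cast; linarith
    have b0 : |cocycle (fun _ => E) m 0 0| ≤ (((m + 2 : ℕ) : ℝ) + 1) * t ^ (m + 2) := by
      refine (h m).trans (mul_le_mul ?_ p0 (by positivity) (by positivity))
      push_cast; linarith
    rw [cocycle_const_add_two]
    fin_cases i <;> fin_cases j
    · exact b2
    · simpa using b1
    · exact b1
    · simpa using b0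
  obtain ⟨y, hy⟩ := exists_lt_norm_transferMatrix α 0 v E (n := m + 2) (by omega)
    (c := ((m + 2 : ℕ) : ℝ) * Real.log t + Real.log (2 * (((m + 2 : ℕ) : ℝ) + 1))) (by
      have := Real.log_lt_log (by positivity) hn1
      rw [Real.log_exp] at this
      linarith)
  rw [Real.exp_add, Real.exp_log (by positivity), mul_comm (((m + 2 : ℕ) : ℝ)) (Real.log t),
    Real.exp_mul, Real.exp_log ht0, Real.rpow_natCast] at hy
  have := hnorm y
  nlinarith

/-- A positive exponent excludes |E| ≤ 2, and outside this range |P_n| ≥ t^n with log t at least the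
exponent: there are no deviations at all. -/
theorem exp_mul_lyapunov_zero_le {α : ℝ} {v : ℝ → ℝ} {E : ℝ} (hpos : 0 < lyapunov α 0 v E)
    (n : ℕ) (x : ℝ) : Real.exp (n * lyapunov α 0 v E) ≤ |dirichletDet α 0 v n x E| := by
  rw [abs_dirichletDet]
  simp only [zero_mul, sub_zero]
  by_cases hE : |E| ≤ 2
  · have := lyapunov_zero_le (α := α) (v := v) (E := E) le_rfl
      (fun n => by simpa using abs_cocycle_const_le hE n)
    rw [Real.log_one] at this
    linarith
  · obtain ⟨t, ht, h⟩ := exists_cocycle_const_bounds (not_le.1 hE)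
    have h1 := lyapunov_zero_le (α := α) (v := v) ht (fun n => (h n).2)
    refine le_trans ?_ (h n).1
    calc Real.exp (n * lyapunov α 0 v E) ≤ Real.exp (n * Real.log t) := by gcongr
      _ = t ^ n := by rw [mul_comm, Real.exp_mul, Real.exp_log (by linarith), Real.rpow_natCast]

/-! ### The large deviation estimate. -/

theorem theorem5p2 (γm γp lam er E₁ E₂ : ℝ) (hγm : 0 < γm) (hγp : 0 < γp) (her : er < 1) :
    ∃ C : ℝ, 0 < C ∧ ∀ δ : ℝ, 0 < δ → ∃ q₀ : ℕ, 0 < q₀ ∧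
      ∀ α : ℝ, Irrational α → erExponent α < er →
      ∀ v : ℝ → ℝ, IsSawtoothPotential v γm γp →
      ∀ E ∈ Set.Icc E₁ E₂, 0 < lyapunov α lam v E →
      ∀ q ∈ goodDenominators α er, q₀ ≤ q →
        volume (deviationSet α lam v q E δ) < ENNReal.ofReal (Real.exp (-(C * δ * q))) ∧
        CoveredByArcs (deviationSet α lam v q E δ) q (Real.exp (-(C * δ * q))) := by
  -- 176 = 2 · 88: the threshold η decays at rate δ/88, and half of that rate is spent on absorbing
  -- the factor 4q/(|lam| γ₋) in the measure.
  refine ⟨1 / 176, by norm_num, fun δ hδ => ?_⟩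
  by_cases hlam : lam = 0
  · subst hlam
    refine ⟨1, one_pos, fun α _ _ v _ E _ hL q _ _ => ?_⟩
    have hempty : deviationSet α 0 v q E δ = ∅ := by
      refine Set.eq_empty_of_forall_notMem fun x hx => ?_
      have h1 := exp_mul_lyapunov_zero_le hL q x
      have h2 : Real.exp (q * (lyapunov α 0 v E - δ)) ≤ Real.exp (q * lyapunov α 0 v E) := by
        gcongr; linarith
      exact absurd hx.2 (not_lt.2 (h2.trans h1))
    rw [hempty]
    exact ⟨by simp [Real.exp_pos], fun _ => 0, by simp⟩
  obtain ⟨s, hs, hslam⟩ : ∃ s : ℝ, s ^ 2 = 1 ∧ s * lam = |lam| := by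
    rcases lt_or_gt_of_ne hlam with h | h
    · exact ⟨-1, by norm_num, by rw [abs_of_neg h]; ring⟩
    · exact ⟨1, by norm_num, by rw [abs_of_pos h]; ring⟩
  have hκ : 0 < s * lam := hslam ▸ abs_pos.2 hlam
  have hκγ : 0 < s * lam * γm := mul_pos hκ hγm
  set K := |lam| + max |E₁| |E₂| + 4 with hK
  have hK0 : 0 < K := by positivity
  obtain ⟨q₀, hq₀⟩ := eventually_atTop.1 ((eventually_ge_atTop 2).and
    ((eventually_mul_lt_exp (8 * K ^ 44) (show 0 < δ / 4 by positivity)).and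
      (eventually_mul_lt_exp (4 / (s * lam * γm)) (show 0 < δ / 176 by positivity))))
  refine ⟨q₀ + 1, by omega, fun α hα _ v hv E hE _ q hqG hq => ?_⟩
  obtain ⟨hq2, hqK, hql⟩ := hq₀ q (by omega)
  obtain ⟨k, rfl, -⟩ := hqG
  set q := cfDen α (k + 1) with hqdef
  have hgood := isGoodApprox_cfDen α hα (k + 1)
  rw [← hqdef] at hgood
  have hqR : (2 : ℝ) ≤ q := by exact_mod_cast hq2
  choose a U ha hU hA using fun x : ℝ => exists_monotone_diagonalization
    (jacobi s (fun m => s * lam * v (x + m * α) + -(s * E)) q) (jacobi_isSymm _ _ _)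
  -- Chosen so that η^44 costs δ/2. With δ/4 lost in the norm at y and δ/4 in the constant 8K^44,
  -- the total is exactly δ, which contradicts the strict inequality `h4`.
  set η := Real.exp (-(δ * q / 88)) with hη
  have hη0 : 0 < η := Real.exp_pos _
  have hη1 : η ≤ 1 := Real.exp_le_one_iff.2 (by simp; positivity)
  have hEK : |lam| + |E| + 4 ≤ K := by
    have : |E| ≤ max |E₁| |E₂| := abs_le_max_abs_abs hE.1 hE.2
    linarith only [this, hK]
  have hsub : deviationSet α lam v q E δ ⊆ {x | ∃ j, |a x j| < η} := by
    intro x hx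
    by_contra hcon
    simp only [Set.mem_ofPred_eq, not_exists, not_lt] at hcon
    obtain ⟨y, hy⟩ := exists_lt_norm_transferMatrix α lam v E hgood.pos
      (c := q * lyapunov α lam v E - δ * q / 4) (by
        have : 0 < δ * q / 4 := by positivity
        linarith only [this])
    have h1 := norm_transferMatrix_le hgood hq2 hv hγm hs hκ.le E x y (ha x) (hU x) (hA x)
      hη0 hη1 hcon
    have h2 : η ^ 44 = Real.exp (-(δ * q / 2)) := by
      rw [hη, ← Real.exp_nat_mul]; congr 1; push_cast; ring
    have h3 : 8 * (|lam| + |E| + 4) ^ 44 ≤ Real.exp (δ / 4 * q) := by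
      have : (|lam| + |E| + 4) ^ 44 ≤ K ^ 44 := by gcongr
      calc _ ≤ 8 * K ^ 44 := mul_le_mul_of_nonneg_left this (by norm_num)
        _ ≤ 8 * K ^ 44 * (q + 1) := le_mul_of_one_le_right (by positivity) (by linarith only [hqR])
        _ ≤ _ := hqK.le
    have h4 : Real.exp (q * lyapunov α lam v E - δ * q / 4) * η ^ 44 <
        Real.exp (δ / 4 * q) * Real.exp (q * (lyapunov α lam v E - δ)) := by
      calc _ < ‖Matrix.toEuclideanCLM (𝕜 := ℝ) (transferMatrix α lam v y E q)‖ * η ^ 44 :=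
            mul_lt_mul_of_pos_right hy (by positivity)
        _ ≤ _ := h1
        _ ≤ _ := mul_le_mul h3 hx.2.le (abs_nonneg _) (Real.exp_pos _).le
    rw [h2, ← Real.exp_add, ← Real.exp_add, Real.exp_lt_exp] at h4
    linarith only [h4]
  clear hqK
  have hcov := coveredByArcs_small_eigenvalue hα hv hγm hκ s (-(s * E)) ha hU hA η
  set l := 2 * η / (s * lam * γm) with hl
  have hl0 : 0 ≤ l := by positivity
  have hvol : 2 * q * l < Real.exp (-(1 / 176 * δ * q)) := by
    -- One factor is the required bound; the other beats the linear growth in q.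
    have e1 : η = Real.exp (-(1 / 176 * δ * q)) * Real.exp (-(1 / 176 * δ * q)) := by
      rw [hη, ← Real.exp_add]; congr 1; ring
    have e2 : 2 * q * l = 4 / (s * lam * γm) * q * η := by rw [hl]; ring
    have e3 : 4 / (s * lam * γm) * q < Real.exp (δ / 176 * q) := by
      have : 0 < 4 / (s * lam * γm) := by positivity
      nlinarith
    have e4 : Real.exp (δ / 176 * q) * Real.exp (-(1 / 176 * δ * q)) = 1 := by
      rw [← Real.exp_add, Real.exp_eq_one_iff]; ring
    have e5 := Real.exp_pos (-(1 / 176 * δ * q))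
    calc 2 * q * l < Real.exp (δ / 176 * q) * η := by
          rw [e2]; exact mul_lt_mul_of_pos_right e3 hη0
      _ = Real.exp (-(1 / 176 * δ * q)) := by rw [e1, ← mul_assoc, e4, one_mul]
  have hexp1 : Real.exp (-(1 / 176 * δ * q)) ≤ 1 := Real.exp_le_one_iff.2 (by simp; positivity)
  have hl2 : l ≤ 2 * q * l := by nlinarith
  refine ⟨?_, hcov.mono hsub (hl2.trans hvol.le)⟩
  refine ((hcov.mono hsub le_rfl).volume_le (fun x hx => hx.1) hl0 (by linarith)).trans_lt ?_
  exact (ENNReal.ofReal_lt_ofReal_iff (Real.exp_pos _)).2 hvol
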